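/- \textbf{Setting.} Let $s\ge 1$ and let $B$ be a square braid on $s$ strands, i.e. $B=w^2$ for some $w$ in the braid group on $s$ strands. A \emph{Fourier parametrization} of $B$ consists of real trigonometric polynomials $F_C,G_C$, one pair for each component $C$ of the closure of $B$, such that the $s$ curves $$t\mapsto\Big(F_C\big(\tfrac{t+2\pi j}{s_C}\big),\,G_C\big(\tfrac{t+2\pi j}{s_C}\big),\,t\Big),\qquad 1\le j\le s_C,\ 0\le t\le 2\pi,$$ where $s_C$ is the number of strands of $C$, are pairwise disjoint and form a closed geometric braid which represents $B$ (after its endpoints are moved to the standard base points). Since $B$ is a square, the parametrization is taken to run twice through a closed braid: the set of the $s$ points at time $t+\pi$ is the same as at time $t$. Assume moreover that $$\psi_0(e^{it})=a^s\prod_{C}\prod_{j=1}^{s_C}\Big(F_C\big(\tfrac{t+2\pi j}{s_C}\big)+iG_C\big(\tfrac{t+2\pi j}{s_C}\big)\Big)\neq 0\quad\text{for all } t,$$ where $a>0$ is a given number. Put $$g_a(u,e^{it})=\prod_{C}\prod_{j=1}^{s_C}\Big(u-a\big(F_C(\tfrac{t+2\pi j}{s_C})+iG_C(\tfrac{t+2\pi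 j}{s_C})\big)\Big),\qquad p_{a,k}(u,v,\bar v)=(v\bar v)^{sk}\,g_a\Big(\frac{u}{(v\bar v)^k},\frac{v}{\sqrt{v\bar v}}\Big).$$ For a mixed polynomial $f(z,\bar z)=\sum c_{\nu,\mu}z^\nu\bar z^\mu$ in $n$ complex variables and a weight vector $P$ of positive integers, let $f_P$ be the sum of the terms of $f$ with minimal radial degree $\sum_j P_j(\nu_j+\mu_j)$. The polynomial $f$ is \emph{non-degenerate} (resp. \emph{strongly non-degenerate}) if for every such $P$ the map $f_P:(\mathbb C^*)^n\to\mathbb C$, as a real smooth map, has no critical point on $f_P^{-1}(0)$ (resp. no critical point at all). It is \emph{convenient} if its radial Newton polygon $\Gamma_+(f)$, the convex hull of $\bigcup_{c_{\nu,\mu}\ne0}\big((\nu+\mu)+\mathbb R_{\ge0}^n\big)$, meets every coordinate axis. \textbf{Theorem.} There is a positive integer $n'$ such that for every integer $N\ge n'$ there is a positive integer $k_0$ such that for every integer $k\ge k_0$ the following holds. The function $p_{a,k}$ is (the restriction to $v\ne0$ of) a mixed polynomial, and for every non-degenerate complex polynomial $$q(u,v)=u^m+\sum_{j=0}^{m-1}\theta_j(v)u^j,\qquad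 m\ge1,\ \theta_j\in\mathbb C[v],\qquad \operatorname{ord}\theta_0=n_m=N,$$ the mixed polynomial $f=p_{a,k}\cdot q$ is strongly non-degenerate and convenient. (Thus $n'$ depends only on $g_a$, and $k$ has to be large depending on $g_a$ and on $n_m$, but not otherwise on $q$.) -/

import Mathlib

open scoped ComplexConjugate

/-! ### Braids -/

/-- Ordered configurations of `s` pairwise distinct points of the plane. -/
abbrev OrdConf (s : ℕ) : Type := {z : Fin s → ℂ // Function.Injective z}

/-- Two ordered configurations are identified if they differ by a relabelling of the points. -/
instance ordConfSetoid (s : ℕ) : Setoid (OrdConf s) where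
  r z w := ∃ σ : Equiv.Perm (Fin s), ∀ j, w.1 j = z.1 (σ j)
  iseqv :=
    { refl := fun _ => ⟨1, fun _ => rfl⟩
      symm := by
        rintro z w ⟨σ, h⟩
        exact ⟨σ⁻¹, fun j => by rw [h]; simp⟩
      trans := by
        rintro x y z ⟨σ, h⟩ ⟨τ, h'⟩
        exact ⟨σ * τ, fun j => by rw [h', h]; rfl⟩ }

/-- The space of unordered configurations of `s` points of the plane, with the quotient
topology. -/
abbrev UConf (s : ℕ) : Type := Quotient (ordConfSetoid s)

/-- The base configuration `{0, 1, …, s - 1}`. -/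
def baseConf (s : ℕ) : UConf s :=
  Quotient.mk (ordConfSetoid s) ⟨fun j => ((j : ℕ) : ℂ), fun i j h => by
    have h' : ((i : ℕ) : ℂ) = ((j : ℕ) : ℂ) := h
    exact Fin.ext (by exact_mod_cast h')⟩

/-- The braid group on `s` strands: isotopy classes of geometric braids with endpoints in the
base configuration, that is, homotopy classes of loops in the unordered configuration space. -/
abbrev BraidGroup (s : ℕ) : Type := FundamentalGroup (UConf s) (baseConf s)

/-! ### Fourier parametrizations -/

/-- The value at `t` of the trigonometric polynomial `∑ l, c l * e^{ilt}`. -/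
noncomputable def trigEval (c : ℤ →₀ ℂ) (t : ℝ) : ℂ :=
  c.sum fun l x => x * Complex.exp ((l : ℂ) * (t : ℂ) * Complex.I)

/-- A Fourier parametrization of a closed braid on `s` strands. The components of the closure are
indexed by `Fin comps`; the component `C` consists of `len C` strands, and the strand `j` of `C` is
`t ↦ (F_C ((t + 2πj) / len C), G_C ((t + 2πj) / len C), t)`, where `F_C`, `G_C` are real
trigonometric polynomials, given by their Fourier coefficients. The point `(X, Y)` of the plane
is the complex number `X + iY`. -/
structure FourierParam (s : ℕ) where
  comps : ℕ
  len : Fin comps → ℕ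
  len_pos : ∀ C, 0 < len C
  /-- a numbering of all the strands -/
  strand : Fin s ≃ (C : Fin comps) × Fin (len C)
  F : Fin comps → (ℤ →₀ ℂ)
  G : Fin comps → (ℤ →₀ ℂ)
  F_real : ∀ C l, F C (-l) = conj (F C l)
  G_real : ∀ C l, G C (-l) = conj (G C l)
  /-- the strands are pairwise disjoint -/
  disjoint : ∀ t : ℝ, Function.Injective fun x : (C : Fin comps) × Fin (len C) =>
    trigEval (F x.1) ((t + 2 * Real.pi * ((x.2 : ℕ) : ℝ)) / (len x.1 : ℝ)) +
      Complex.I * trigEval (G x.1) ((t + 2 * Real.pi * ((x.2 : ℕ) : ℝ)) / (len x.1 : ℝ))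

namespace FourierParam

variable {s : ℕ}

/-- The position `F_C ((t + 2πj) / s_C) + i G_C ((t + 2πj) / s_C)` of a strand at time `t`. -/
noncomputable def pos (D : FourierParam s) (x : (C : Fin D.comps) × Fin (D.len C)) (t : ℝ) : ℂ :=
  trigEval (D.F x.1) ((t + 2 * Real.pi * ((x.2 : ℕ) : ℝ)) / (D.len x.1 : ℝ)) +
    Complex.I * trigEval (D.G x.1) ((t + 2 * Real.pi * ((x.2 : ℕ) : ℝ)) / (D.len x.1 : ℝ))

/-- The unordered configuration of the `s` strands at time `t`. -/
noncomputable def conf (D : FourierParam s) (t : ℝ) : UConf s :=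
  Quotient.mk (ordConfSetoid s)
    ⟨fun j => D.pos (D.strand j) t, (D.disjoint t).comp D.strand.injective⟩

end FourierParam

theorem continuous_trigEval (c : ℤ →₀ ℂ) : Continuous (trigEval c) := by
  unfold trigEval Finsupp.sum
  fun_prop

theorem trigEval_add_two_pi (c : ℤ →₀ ℂ) (t : ℝ) :
    trigEval c (t + 2 * Real.pi) = trigEval c t := by
  unfold trigEval Finsupp.sum
  refine Finset.sum_congr rfl fun l _ => ?_
  have h : (l : ℂ) * ((t + 2 * Real.pi : ℝ) : ℂ) * Complex.I =
      (l : ℂ) * (t : ℂ) * Complex.I + (l : ℂ) * (2 * (Real.pi : ℂ) * Complex.I) := by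
    push_cast; ring
  simp only [h]
  rw [Complex.exp_add, Complex.exp_int_mul_two_pi_mul_I, mul_one]

namespace FourierParam

variable {s : ℕ}

theorem continuous_pos (D : FourierParam s) (x : (C : Fin D.comps) × Fin (D.len C)) :
    Continuous (D.pos x) := by
  unfold pos
  have hF := continuous_trigEval (D.F x.1)
  have hG := continuous_trigEval (D.G x.1)
  fun_prop

theorem continuous_conf (D : FourierParam s) : Continuous D.conf := by
  unfold conf
  refine continuous_quotient_mk'.comp ?_
  exact Continuous.subtype_mk (continuous_pi fun j => D.continuous_pos _) _

/-- After one turn the strands are permuted cyclically within each component. -/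
theorem conf_two_pi (D : FourierParam s) : D.conf (2 * Real.pi) = D.conf 0 := by
  refine (Quotient.sound ?_).symm
  refine ⟨(D.strand.trans (Equiv.sigmaCongrRight fun C => finRotate (D.len C))).trans
    D.strand.symm, fun j => ?_⟩
  simp only [Equiv.trans_apply, Equiv.apply_symm_apply]
  obtain ⟨C, i⟩ := D.strand j
  simp only [Equiv.sigmaCongrRight_apply]
  have hL : (D.len C : ℝ) ≠ 0 := by exact_mod_cast (D.len_pos C).ne'
  have key : ∀ c : ℤ →₀ ℂ,
      trigEval c ((2 * Real.pi + 2 * Real.pi * ((i : ℕ) : ℝ)) / (D.len C : ℝ)) =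
      trigEval c ((0 + 2 * Real.pi * ((finRotate (D.len C) i : ℕ) : ℝ)) / (D.len C : ℝ)) := by
    intro c
    generalize D.len C = n at i hL
    cases n with
    | zero => exact i.elim0
    | succ n =>
      rcases Fin.eq_castSucc_or_eq_last i with ⟨i', rfl⟩ | rfl
      · rw [finRotate_apply]
        congr 1
        rw [Fin.coeSucc_eq_succ]
        simp only [Fin.val_castSucc, Fin.val_succ]
        push_cast
        ring
      · rw [finRotate_last]
        have h0 : ((2 * Real.pi + 2 * Real.pi * (((Fin.last n : Fin (n + 1)) : ℕ) : ℝ)) /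
            ((n + 1 : ℕ) : ℝ)) = 0 + 2 * Real.pi := by
          rw [Fin.val_last]
          field_simp
          push_cast
          ring
        rw [h0, trigEval_add_two_pi]
        simp
  simp only [pos]
  rw [key, key]

/-- The loop of configurations described by the closed braid, `t ∈ [0, 2π]`. -/
noncomputable def loop (D : FourierParam s) : Path (D.conf 0) (D.conf 0) where
  toFun x := D.conf (2 * Real.pi * (x : ℝ))
  continuous_toFun := D.continuous_conf.comp (by fun_prop)
  source' := by simp
  target' := by simpa using D.conf_two_pi

/-- `D` parametrizes the braid `B`: moving the endpoints of the strands of `D` into the base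
configuration along a suitable path gives a geometric braid that represents `B`. -/
def Parametrizes (D : FourierParam s) (B : BraidGroup s) : Prop :=
  ∃ δ : Path (baseConf s) (D.conf 0),
    B = FundamentalGroup.fromPath (Path.Homotopic.Quotient.mk ((δ.trans D.loop).trans δ.symm))

/-- `D` displays its braid as a square: the second half turn repeats the first one. -/
def IsDoubled (D : FourierParam s) : Prop :=
  ∀ t : ℝ, D.conf (t + Real.pi) = D.conf t

/-- The polynomial `g_a (u, e^{it}) = ∏ (u - a (F_C + i G_C))`, product over all strands. -/
noncomputable def g (D : FourierParam s) (a : ℝ) (u : ℂ) (t : ℝ) : ℂ :=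
  ∏ C, ∏ j : Fin (D.len C), (u - (a : ℂ) * D.pos ⟨C, j⟩ t)

/-- The function `ψ₀ (e^{it}) = a^s ∏ (F_C + i G_C)`, product over all strands. -/
noncomputable def psi (D : FourierParam s) (a : ℝ) (t : ℝ) : ℂ :=
  (a : ℂ) ^ s * ∏ C, ∏ j : Fin (D.len C), D.pos ⟨C, j⟩ t

end FourierParam

/-! ### Mixed polynomials -/

/-- Mixed polynomials in `n` complex variables: `Sum.inl i` stands for `z_i` and `Sum.inr i` for
the conjugate of `z_i`. -/
abbrev MixedPoly (n : ℕ) : Type := MvPolynomial (Fin n ⊕ Fin n) ℂ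

namespace MixedPoly

variable {n : ℕ}

/-- The mapping `ℂⁿ → ℂ` defined by a mixed polynomial. -/
noncomputable def toFun (f : MixedPoly n) (z : Fin n → ℂ) : ℂ :=
  MvPolynomial.eval (Sum.elim z fun i => conj (z i)) f

/-- The exponent `ν + μ` of the mixed monomial `z^ν z̄^μ`. -/
def radExp (d : (Fin n ⊕ Fin n) →₀ ℕ) (i : Fin n) : ℕ := d (Sum.inl i) + d (Sum.inr i)

/-- The radial degree of the mixed monomial `z^ν z̄^μ` with respect to the weight vector `P`. -/
def rdeg (P : Fin n → ℕ) (d : (Fin n ⊕ Fin n) →₀ ℕ) : ℕ := ∑ i, P i * radExp d i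

/-- The radial Newton polygon `Γ₊(f)`. -/
def newtonPolygon (f : MixedPoly n) : Set (Fin n → ℝ) :=
  convexHull ℝ (⋃ d ∈ f.support, {x : Fin n → ℝ | ∀ i, (radExp d i : ℝ) ≤ x i})

/-- `Γ₊(f)` meets every coordinate axis. -/
def Convenient (f : MixedPoly n) : Prop :=
  ∀ j : Fin n, ∃ x ∈ newtonPolygon f, ∀ i, i ≠ j → x i = 0

/-- The face function `f_P`: the sum of the terms of `f` of minimal radial degree. -/
noncomputable def faceFunction (P : Fin n → ℕ) (f : MixedPoly n) : MixedPoly n :=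
  ∑ d ∈ f.support with ∀ e ∈ f.support, rdeg P d ≤ rdeg P e,
    MvPolynomial.monomial d (MvPolynomial.coeff d f)

/-- `z` is a critical point of the mapping `ℂⁿ → ℂ` defined by `f`, as a real smooth map. -/
def IsCritical (f : MixedPoly n) (z : Fin n → ℂ) : Prop :=
  ¬ Function.Surjective (fderiv ℝ f.toFun z)

/-- For every positive weight vector `P`, the fiber over `0` of `f_P : (ℂ*)ⁿ → ℂ` contains no
critical point. -/
def NonDegenerate (f : MixedPoly n) : Prop :=
  ∀ P : Fin n → ℕ, (∀ i, 0 < P i) → ∀ z : Fin n → ℂ, (∀ i, z i ≠ 0) →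
    (faceFunction P f).toFun z = 0 → ¬ IsCritical (faceFunction P f) z

/-- For every positive weight vector `P`, the mapping `f_P : (ℂ*)ⁿ → ℂ` has no critical points. -/
def StronglyNonDegenerate (f : MixedPoly n) : Prop :=
  ∀ P : Fin n → ℕ, (∀ i, 0 < P i) → ∀ z : Fin n → ℂ, (∀ i, z i ≠ 0) →
    ¬ IsCritical (faceFunction P f) z

/-- The complex polynomial `u^m + ∑_{j<m} θ_j(v) u^j`, where `(u, v) = (z_0, z_1)`. -/
noncomputable def monicInU (m : ℕ) (θ : Fin m → Polynomial ℂ) : MixedPoly 2 :=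
  MvPolynomial.X (Sum.inl 0) ^ m +
    ∑ j : Fin m, Polynomial.aeval (MvPolynomial.X (Sum.inl 1) : MixedPoly 2) (θ j) *
      MvPolynomial.X (Sum.inl 0) ^ (j : ℕ)

end MixedPoly

/-- The mixed polynomial `p` in `(u, v) = (z_0, z_1)` is
`p_{a,k} = (v v̄)^{sk} g_a (u / (v v̄)^k, v / √(v v̄))`; note `v / √(v v̄) = e^{i arg v}`. -/
def FourierParam.IsRescaled {s : ℕ} (D : FourierParam s) (a : ℝ) (k : ℕ) (p : MixedPoly 2) :
    Prop :=
  ∀ u v : ℂ, v ≠ 0 → p.toFun ![u, v] =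
    (v * conj v) ^ (s * k) * D.g a (u / (v * conj v) ^ k) v.arg

/-!
The polynomial `g_a(u, e^{it})` is monic in `u` with roots at the points of the parametrization.
Its coefficients are trigonometric polynomials in `t / L` for some `L`, and they have period `π`
because the parametrization is doubled; averaging over the shifts by multiples of `π` shows that
they are trigonometric polynomials in `2t` (`FourierParam.exists_rootPoly_eq_sum`). A term
`e^{2int}` multiplied by `|v|^{2e}`, `e ≥ |n|`, is `v^{e+n} v̄^{e-n}`, and so `p_{a,k}` is a mixed
polynomial for large `k` (`MixedPoly.rescaledPoly`). It is radially homogeneous for the weights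
`(2k, 1)`, and its Newton polygon has the single compact edge from `u^s` to the nonzero part that
depends on `v` only.

Face functions are multiplicative (`MixedPoly.IsFace.mul`). If `2k > N`, the following faces of
`f = p q` occur.

* If `P₀ < 2k P₁`, then `f_P = u^s q_P` is a holomorphic weighted homogeneous polynomial of positive
  degree. On its zero set `q_P` vanishes and is regular by hypothesis; elsewhere the Euler identity
  gives a nonzero derivative.
* If `P₀ ≥ 2k P₁`, then `q_P = c v^N`, and with `u = r^{2k} w`, `v = r e^{it}` one has
  `f_P = c r^M e^{iNt} G(w, t)`, where `G` is `g_a(w, e^{it})` or `g_a(0, e^{it})`. Such a function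
  is regular where `G_w ≠ 0`. Where `G_w = 0` the radial and angular derivatives are independent
  over `ℝ` if `|G_t| < N |G|` (`MixedPoly.not_isCritical_of_polar`).

The critical points of the polynomials `g_a(·, e^{it})` form a compact set by the Gauss–Lucas
theorem, and `g_a` does not vanish on it since its roots are simple; `g_a(0, e^{it})` does not
vanish by hypothesis. Hence `|G_t| / |G|` is bounded there, and `n'` is any larger integer
(`FourierParam.exists_norm_deriv_lt`). This bound depends on `g_a` only.
-/

/-! ### Trigonometric polynomials in a fraction of the angle -/

/-- The functions of `t` that are trigonometric polynomials in `t / L`, as a subalgebra of the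
algebra of all functions. -/
noncomputable def trigAlgebra (L : ℕ) : Subalgebra ℂ (ℝ → ℂ) :=
  Algebra.adjoin ℂ (Set.range fun (n : ℤ) (t : ℝ) => Complex.exp (n * ((t / L : ℝ) : ℂ) * Complex.I))

theorem exp_mem_trigAlgebra (L : ℕ) (n : ℤ) :
    (fun t : ℝ => Complex.exp (n * ((t / L : ℝ) : ℂ) * Complex.I)) ∈ trigAlgebra L :=
  Algebra.subset_adjoin ⟨n, rfl⟩

theorem exists_trigEval_of_mem_span {e : ℝ → ℝ} {h : ℝ → ℂ}
    (hh : h ∈ Submodule.span ℂ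
      (Set.range fun (n : ℤ) (t : ℝ) => Complex.exp (n * ((e t : ℝ) : ℂ) * Complex.I))) :
    ∃ c : ℤ →₀ ℂ, ∀ t, h t = trigEval c (e t) := by
  obtain ⟨c, rfl⟩ := Finsupp.mem_span_range_iff_exists_finsupp.1 hh
  exact ⟨c, fun t => by simp [trigEval, Finsupp.sum]⟩

theorem exists_trigEval_of_mem_trigAlgebra {L : ℕ} {h : ℝ → ℂ} (hh : h ∈ trigAlgebra L) :
    ∃ c : ℤ →₀ ℂ, ∀ t, h t = trigEval c (t / L) := by
  refine exists_trigEval_of_mem_span (e := fun t => t / L) ?_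
  let φ : Multiplicative ℤ →* (ℝ → ℂ) :=
    { toFun := fun n t => Complex.exp ((n.toAdd : ℂ) * ((t / L : ℝ) : ℂ) * Complex.I)
      map_one' := by ext; simp
      map_mul' := fun x y => by
        ext t
        simp only [toAdd_mul, Pi.mul_apply, ← Complex.exp_add]
        push_cast
        ring_nf }
  have h1 : Submonoid.closure (Set.range fun (n : ℤ) (t : ℝ) =>
      Complex.exp (n * ((t / L : ℝ) : ℂ) * Complex.I)) = MonoidHom.mrange φ := by
    rw [← Submonoid.closure_eq (MonoidHom.mrange φ)]
    rfl
  have h2 : h ∈ Subalgebra.toSubmodule (trigAlgebra L) := hh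
  rw [trigAlgebra, Algebra.adjoin_eq_span, h1] at h2
  exact h2

theorem trigEval_shift_mem_trigAlgebra {l L : ℕ} (hl : l ∣ L) (hL : 0 < L) (c : ℤ →₀ ℂ) (x : ℝ) :
    (fun t : ℝ => trigEval c ((t + x) / l)) ∈ trigAlgebra L := by
  obtain ⟨q, rfl⟩ := hl
  have hl0 : (l : ℂ) ≠ 0 := by
    rintro h; simp [Nat.cast_eq_zero.1 h] at hL
  have hq0 : (q : ℂ) ≠ 0 := by
    rintro h; simp [Nat.cast_eq_zero.1 h] at hL
  have : (fun t : ℝ => trigEval c ((t + x) / l)) =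
      ∑ n ∈ c.support, (c n * Complex.exp (n * ((x / l : ℝ) : ℂ) * Complex.I)) •
        (fun t : ℝ => Complex.exp (((n * q : ℤ) : ℂ) * ((t / (l * q : ℕ) : ℝ) : ℂ) * Complex.I)) := by
    ext t
    simp only [trigEval, Finsupp.sum, Finset.sum_apply, Pi.smul_apply, smul_eq_mul]
    refine Finset.sum_congr rfl fun n _ => ?_
    rw [mul_assoc (c n), ← Complex.exp_add]
    congr 2
    push_cast
    field_simp
    ring
  rw [this]
  exact sum_mem fun n _ => Subalgebra.smul_mem _ (exp_mem_trigAlgebra _ _) _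

/-- Averaging over the shifts by multiples of `π` removes the frequencies that are not even
integers. -/
theorem exists_trigEval_two_mul {L : ℕ} (hL : 0 < L) {h : ℝ → ℂ} (hh : h ∈ trigAlgebra L)
    (hper : ∀ t, h (t + Real.pi) = h t) :
    ∃ c : ℤ →₀ ℂ, ∀ t, h t = trigEval c (2 * t) := by
  obtain ⟨c, hc⟩ := exists_trigEval_of_mem_trigAlgebra hh
  refine exists_trigEval_of_mem_span (e := fun t => 2 * t) ?_
  have hL0 : (L : ℂ) ≠ 0 := by exact_mod_cast hL.ne'
  have hperj : ∀ (j : ℕ) t, h (t + j * Real.pi) = h t := by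
    intro j
    induction j with
    | zero => simp
    | succ j ih =>
      intro t
      rw [← ih t, ← hper (t + j * Real.pi)]
      push_cast
      ring_nf
  have havg : h = ∑ n ∈ c.support, (c n * (2 * L : ℂ)⁻¹) • (fun t : ℝ =>
      ∑ j ∈ Finset.range (2 * L),
        Complex.exp (n * (((t + j * Real.pi) / L : ℝ) : ℂ) * Complex.I)) := by
    ext t
    have h1 : (2 * L : ℂ) * h t = ∑ j ∈ Finset.range (2 * L), h (t + j * Real.pi) := by
      simp [hperj]
    have h2 : h t = (2 * L : ℂ)⁻¹ * ∑ j ∈ Finset.range (2 * L), h (t + j * Real.pi) := by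
      rw [← h1]; field_simp
    rw [h2]
    simp only [hc, trigEval, Finsupp.sum, Finset.sum_apply, Pi.smul_apply, smul_eq_mul]
    rw [Finset.sum_comm, Finset.mul_sum]
    refine Finset.sum_congr rfl fun n _ => ?_
    rw [← Finset.mul_sum]
    ring
  rw [havg]
  refine Submodule.sum_mem _ fun n _ => Submodule.smul_mem _ _ ?_
  -- the average of the `n`th term is a geometric sum, which vanishes unless `ζ = 1`
  set ζ : ℂ := Complex.exp (n * ((Real.pi / L : ℝ) : ℂ) * Complex.I) with hζ
  have hsum : (fun t : ℝ => ∑ j ∈ Finset.range (2 * L),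
      Complex.exp (n * (((t + j * Real.pi) / L : ℝ) : ℂ) * Complex.I)) =
      (∑ j ∈ Finset.range (2 * L), ζ ^ j) •
        fun t : ℝ => Complex.exp (n * ((t / L : ℝ) : ℂ) * Complex.I) := by
    ext t
    simp only [Pi.smul_apply, smul_eq_mul, Finset.sum_mul, hζ, ← Complex.exp_nat_mul,
      ← Complex.exp_add]
    refine Finset.sum_congr rfl fun j _ => ?_
    congr 1
    push_cast
    ring
  rw [hsum]
  have hζ1 : ζ ^ (2 * L) = 1 := by
    rw [hζ, ← Complex.exp_nat_mul, ← Complex.exp_int_mul_two_pi_mul_I n]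
    congr 1
    push_cast
    field_simp
  by_cases h1 : ζ = 1
  · obtain ⟨m, hm⟩ := Complex.exp_eq_one_iff.1 (hζ ▸ h1)
    have hn : (n : ℂ) = m * (2 * L) := by
      have hpi : (Real.pi : ℂ) ≠ 0 := by exact_mod_cast Real.pi_ne_zero
      have hI := Complex.I_ne_zero
      push_cast at hm
      field_simp at hm
      rw [hm]; ring
    refine Submodule.smul_mem _ _ (Submodule.subset_span ⟨m, ?_⟩)
    ext t
    rw [hn]
    push_cast
    field_simp
  · have : ∑ j ∈ Finset.range (2 * L), ζ ^ j = 0 := by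
      rw [geom_sum_eq h1, hζ1, sub_self, zero_div]
    rw [this, zero_smul]
    exact Submodule.zero_mem _

theorem contDiff_trigEval (c : ℤ →₀ ℂ) : ContDiff ℝ 1 (trigEval c) := by
  unfold trigEval Finsupp.sum
  refine ContDiff.sum fun l _ => contDiff_const.mul (ContDiff.cexp ?_)
  exact (contDiff_const.mul Complex.ofRealCLM.contDiff).mul contDiff_const

/-! ### The polynomial whose roots are the points of a Fourier parametrization -/

namespace FourierParam

variable {s : ℕ}

/-- The polynomial in `u` with roots `a (F_C + i G_C)`, one for each strand. -/
noncomputable def rootPoly (D : FourierParam s) (a : ℝ) (t : ℝ) : Polynomial ℂ :=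
  ∏ i : Fin s, (Polynomial.X - Polynomial.C ((a : ℂ) * D.pos (D.strand i) t))

theorem rootPoly_eval (D : FourierParam s) (a : ℝ) (u : ℂ) (t : ℝ) :
    (D.rootPoly a t).eval u = D.g a u t := by
  rw [rootPoly, g, Polynomial.eval_prod, ← Fintype.prod_sigma'
    (fun C (j : Fin (D.len C)) => u - (a : ℂ) * D.pos ⟨C, j⟩ t)]
  exact Fintype.prod_equiv D.strand _ _ fun i => by simp

theorem rootPoly_eval_zero (D : FourierParam s) (a : ℝ) (t : ℝ) :
    (D.rootPoly a t).eval 0 = (-1) ^ s * D.psi a t := by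
  rw [rootPoly, psi, Polynomial.eval_prod, ← Fintype.prod_sigma'
    (fun C (j : Fin (D.len C)) => D.pos ⟨C, j⟩ t)]
  rw [← Fintype.prod_equiv D.strand (fun i => D.pos (D.strand i) t) _ fun i => rfl]
  simp only [Polynomial.eval_sub, Polynomial.eval_X, Polynomial.eval_C, zero_sub,
    ← neg_one_mul ((a : ℂ) * _), Finset.prod_mul_distrib, Finset.prod_const, Finset.card_univ,
    Fintype.card_fin]

theorem rootPoly_monic (D : FourierParam s) (a : ℝ) (t : ℝ) : (D.rootPoly a t).Monic :=
  Polynomial.monic_prod_of_monic _ _ fun _ _ => Polynomial.monic_X_sub_C _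

theorem rootPoly_natDegree (D : FourierParam s) (a : ℝ) (t : ℝ) :
    (D.rootPoly a t).natDegree = s := by
  rw [rootPoly, Polynomial.natDegree_finsetProd_X_sub_C_eq_card]
  simp

theorem rootPoly_separable (D : FourierParam s) {a : ℝ} (ha : 0 < a) (t : ℝ) :
    (D.rootPoly a t).Separable := by
  rw [rootPoly, Polynomial.separable_prod_X_sub_C_iff]
  have ha' : (a : ℂ) ≠ 0 := by exact_mod_cast ha.ne'
  exact (mul_right_injective₀ ha').comp ((D.disjoint t).comp D.strand.injective)

theorem rootPoly_add_pi (D : FourierParam s) (hsq : D.IsDoubled) (a : ℝ) (t : ℝ) :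
    D.rootPoly a (t + Real.pi) = D.rootPoly a t := by
  obtain ⟨σ, hσ⟩ := Quotient.exact (hsq t)
  exact (Fintype.prod_equiv σ _ _ fun j => by
    rw [show D.pos (D.strand j) t = D.pos (D.strand (σ j)) (t + Real.pi) from hσ j]).symm

theorem pos_mem_trigAlgebra (D : FourierParam s) (x : (C : Fin D.comps) × Fin (D.len C)) :
    D.pos x ∈ trigAlgebra (∏ C, D.len C) := by
  have hl : D.len x.1 ∣ ∏ C, D.len C := Finset.dvd_prod_of_mem _ (Finset.mem_univ _)
  have hL : 0 < ∏ C, D.len C := Finset.prod_pos fun C _ => D.len_pos C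
  exact add_mem (trigEval_shift_mem_trigAlgebra hl hL (D.F x.1) _)
    (Subalgebra.smul_mem _ (trigEval_shift_mem_trigAlgebra hl hL (D.G x.1) _) Complex.I)

/-- The product is formed over the ring of functions of `t`, where all linear factors have
coefficients in the subalgebra. -/
theorem rootPoly_coeff_mem_trigAlgebra (D : FourierParam s) (a : ℝ) (j : ℕ) :
    (fun t => (D.rootPoly a t).coeff j) ∈ trigAlgebra (∏ C, D.len C) := by
  set A := trigAlgebra (∏ C, D.len C)
  let R : Polynomial (ℝ → ℂ) :=
    ∏ i : Fin s, (Polynomial.X - Polynomial.C ((a : ℂ) • D.pos (D.strand i)))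
  have hR : R ∈ Polynomial.liftsRing (algebraMap A (ℝ → ℂ)) := by
    refine prod_mem fun i _ => sub_mem ?_ ?_
    · exact (Polynomial.lifts_iff_liftsRing _ _).1 (Polynomial.X_mem_lifts _)
    · refine (Polynomial.lifts_iff_liftsRing _ _).1 (Polynomial.C'_mem_lifts ?_)
      exact ⟨⟨_, A.smul_mem (D.pos_mem_trigAlgebra _) _⟩, rfl⟩
  obtain ⟨b, hb⟩ := (Polynomial.lifts_iff_coeff_lifts _).1
    ((Polynomial.lifts_iff_liftsRing _ _).2 hR) j
  have : (fun t => (D.rootPoly a t).coeff j) = b := by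
    refine Eq.trans ?_ hb.symm
    ext t
    have h : R.map (Pi.evalRingHom (fun _ : ℝ => ℂ) t) = D.rootPoly a t := by
      simp [R, rootPoly, Polynomial.map_prod]
    rw [← h, Polynomial.coeff_map]
    rfl
  rw [this]
  exact b.2

/-- Since the strands at times `t` and `t + π` form the same set, the coefficients of `g_a` are
trigonometric polynomials in `2t`. -/
theorem exists_rootPoly_eq_sum (D : FourierParam s) (hsq : D.IsDoubled) (a : ℝ) :
    ∃ d : ℕ → (ℤ →₀ ℂ), d s = Finsupp.single 0 1 ∧ ∀ t, D.rootPoly a t =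
      ∑ j ∈ Finset.range (s + 1),
        Polynomial.C (trigEval (d j) (2 * t)) * Polynomial.X ^ j := by
  have hL : 0 < ∏ C, D.len C := Finset.prod_pos fun C _ => D.len_pos C
  choose d hd using fun j => exists_trigEval_two_mul hL (D.rootPoly_coeff_mem_trigAlgebra a j)
    fun t => by rw [D.rootPoly_add_pi hsq]
  refine ⟨Function.update d s (Finsupp.single 0 1), by simp, fun t => ?_⟩
  rw [(D.rootPoly a t).as_sum_range' (s + 1) (by rw [rootPoly_natDegree]; omega)]
  refine Finset.sum_congr rfl fun j _ => ?_
  rw [← Polynomial.C_mul_X_pow_eq_monomial]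
  congr 2
  by_cases h : j = s
  · subst h
    have := (D.rootPoly_monic a t).coeff_natDegree
    rw [rootPoly_natDegree] at this
    simp [this, trigEval]
  · rw [Function.update_of_ne h, ← hd]

/-! ### The angular derivative at the critical points of `g_a` -/

/-- By the Gauss–Lucas theorem the critical points lie in the convex hull of the roots, which are
bounded uniformly in `t`. -/
theorem exists_norm_le_of_rootPoly_derivative_eval_eq_zero (hs : 0 < s) (D : FourierParam s)
    (a : ℝ) : ∃ M : ℝ, ∀ t ∈ Set.Icc (-Real.pi) Real.pi, ∀ w : ℂ,
      (D.rootPoly a t).derivative.eval w = 0 → ‖w‖ ≤ M := by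
  have hb : ∀ i : Fin s, ∃ M : ℝ, ∀ t ∈ Set.Icc (-Real.pi) Real.pi,
      ‖(a : ℂ) * D.pos (D.strand i) t‖ ≤ M := fun i =>
    isCompact_Icc.exists_bound_of_continuousOn
      (continuous_const.mul (D.continuous_pos _)).continuousOn
  choose M hM using hb
  have hne : (Finset.univ : Finset (Fin s)).Nonempty := ⟨⟨0, hs⟩, Finset.mem_univ _⟩
  refine ⟨Finset.univ.sup' hne M, fun t ht w hw => ?_⟩
  have hdeg : 0 < (D.rootPoly a t).degree := by
    rw [Polynomial.degree_eq_natDegree (D.rootPoly_monic a t).ne_zero, rootPoly_natDegree]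
    exact_mod_cast hs
  have hd0 : (D.rootPoly a t).derivative ≠ 0 := by
    intro h
    have := Polynomial.derivative_eq_zero.1 h
    rw [rootPoly_natDegree] at this
    omega
  have hmem : w ∈ (D.rootPoly a t).derivative.rootSet ℂ := by
    rw [Polynomial.mem_rootSet]
    exact ⟨hd0, by simpa using hw⟩
  have hsub : (D.rootPoly a t).rootSet ℂ ⊆ Metric.closedBall 0 (Finset.univ.sup' hne M) := by
    intro z hz
    have hz0 : (D.rootPoly a t).eval z = 0 := by
      simpa using (Polynomial.mem_rootSet.1 hz).2
    rw [rootPoly, Polynomial.eval_prod, Finset.prod_eq_zero_iff] at hz0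
    obtain ⟨i, -, hi⟩ := hz0
    rw [Polynomial.eval_sub, Polynomial.eval_X, Polynomial.eval_C, sub_eq_zero] at hi
    rw [mem_closedBall_zero_iff, hi]
    exact (hM i t ht).trans (Finset.le_sup' M (Finset.mem_univ i))
  have := convexHull_min hsub (convex_closedBall _ _)
    (Polynomial.rootSet_derivative_subset_convexHull_rootSet hdeg hmem)
  exact mem_closedBall_zero_iff.1 this

/-- On the compact set of critical points of the polynomials `g_a(·, e^{it})`, to which the points
`u = 0` are added, `g_a` does not vanish, so its logarithmic derivative in `t` is bounded there. -/
theorem exists_norm_deriv_lt (hs : 0 < s) (D : FourierParam s) {a : ℝ} (ha : 0 < a)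
    (hψ : ∀ t, D.psi a t ≠ 0) {b : ℕ → ℝ → ℂ} (hb : ∀ j, ContDiff ℝ 1 (b j))
    (hD : ∀ t, D.rootPoly a t =
      ∑ j ∈ Finset.range (s + 1), Polynomial.C (b j t) * Polynomial.X ^ j) :
    ∃ n : ℕ, 0 < n ∧ ∀ t ∈ Set.Icc (-Real.pi) Real.pi, ∀ w : ℂ,
      w = 0 ∨ (D.rootPoly a t).derivative.eval w = 0 →
        (D.rootPoly a t).eval w ≠ 0 ∧
        ‖∑ j ∈ Finset.range (s + 1), deriv (b j) t * w ^ j‖ < n * ‖(D.rootPoly a t).eval w‖ := by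
  have hbc : ∀ j, Continuous (b j) := fun j => (hb j).continuous
  have hbd : ∀ j, Continuous (deriv (b j)) := fun j => (hb j).continuous_deriv_one
  have hne : ∀ t w, w = 0 ∨ (D.rootPoly a t).derivative.eval w = 0 →
      (D.rootPoly a t).eval w ≠ 0 := by
    rintro t w (rfl | hw) h0
    · rw [rootPoly_eval_zero] at h0
      exact mul_ne_zero (pow_ne_zero _ (by norm_num)) (hψ t) h0
    · exact (D.rootPoly_separable ha t).eval₂_derivative_ne_zero (RingHom.id ℂ)
        (by simpa using h0) (by simpa using hw)
  have hev : Continuous fun x : ℂ × ℝ => (D.rootPoly a x.2).eval x.1 := by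
    simp only [hD, Polynomial.eval_finsetSum, Polynomial.eval_mul, Polynomial.eval_C,
      Polynomial.eval_pow, Polynomial.eval_X]
    fun_prop
  have hdev : Continuous fun x : ℂ × ℝ => (D.rootPoly a x.2).derivative.eval x.1 := by
    simp only [hD, Polynomial.derivative_sum, Polynomial.eval_finsetSum,
      Polynomial.derivative_C_mul_X_pow, Polynomial.eval_mul, Polynomial.eval_C,
      Polynomial.eval_pow, Polynomial.eval_X]
    fun_prop
  have htd : Continuous fun x : ℂ × ℝ =>
      ∑ j ∈ Finset.range (s + 1), deriv (b j) x.2 * x.1 ^ j := by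
    fun_prop
  obtain ⟨M, hM⟩ := D.exists_norm_le_of_rootPoly_derivative_eval_eq_zero hs a
  let K : Set (ℂ × ℝ) := (Metric.closedBall 0 (max M 0) ×ˢ Set.Icc (-Real.pi) Real.pi) ∩
    {x | x.1 = 0 ∨ (D.rootPoly a x.2).derivative.eval x.1 = 0}
  have hK : IsCompact K := by
    refine ((isCompact_closedBall _ _).prod isCompact_Icc).inter_right ?_
    exact (isClosed_eq continuous_fst continuous_const).union (isClosed_eq hdev continuous_const)
  obtain ⟨C, hC⟩ := hK.exists_bound_of_continuousOn
    (f := fun x : ℂ × ℝ => (∑ j ∈ Finset.range (s + 1), deriv (b j) x.2 * x.1 ^ j) /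
      (D.rootPoly a x.2).eval x.1)
    (htd.continuousOn.div hev.continuousOn fun x hx => hne x.2 x.1 hx.2)
  obtain ⟨n, hn⟩ := exists_nat_gt (max C 0)
  refine ⟨n, by exact_mod_cast (le_max_right C 0).trans_lt hn, fun t ht w hw => ⟨hne t w hw, ?_⟩⟩
  have hwK : (w, t) ∈ K := by
    refine ⟨⟨mem_closedBall_zero_iff.2 ?_, ht⟩, hw⟩
    rcases hw with rfl | hw
    · simp
    · exact (hM t ht w hw).trans (le_max_left _ _)
  have h := (hC _ hwK).trans_lt ((le_max_left C 0).trans_lt hn)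
  rwa [norm_div, div_lt_iff₀ (norm_pos_iff.2 (hne t w hw))] at h

end FourierParam

/-! ### Face functions -/

namespace MixedPoly

variable {n : ℕ}

/-- The weights of the variables `z_i`, `z̄_i` for which the weighted degree is the radial degree
with respect to `P`. -/
def radWeight (P : Fin n → ℕ) : Fin n ⊕ Fin n → ℕ := Sum.elim P P

theorem rdeg_eq_weight (P : Fin n → ℕ) (d : (Fin n ⊕ Fin n) →₀ ℕ) :
    rdeg P d = Finsupp.weight (radWeight P) d := by
  simp only [rdeg, radExp, Finsupp.weight_eq_sum, Fintype.sum_sum_type, radWeight, Sum.elim_inl,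
    Sum.elim_inr, smul_eq_mul, ← Finset.sum_add_distrib]
  exact Finset.sum_congr rfl fun i _ => by ring

/-- All terms of `f` have radial degree at least `D`. -/
def OrderGE (P : Fin n → ℕ) (D : ℕ) (f : MixedPoly n) : Prop :=
  ∀ d ∈ f.support, D ≤ rdeg P d

/-- `h` is the nonzero face function of `f` for the weights `P`, and `D` is its radial degree. -/
structure IsFace (P : Fin n → ℕ) (D : ℕ) (h f : MixedPoly n) : Prop where
  homogeneous : h.IsWeightedHomogeneous (radWeight P) D
  ne_zero : h ≠ 0
  orderGE_sub : OrderGE P (D + 1) (f - h)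

variable {P : Fin n → ℕ} {D E : ℕ} {f g h : MixedPoly n}

theorem OrderGE.mono (hf : OrderGE P D f) (hE : E ≤ D) : OrderGE P E f :=
  fun d hd => hE.trans (hf d hd)

theorem OrderGE.zero : OrderGE P D (0 : MixedPoly n) := by
  intro d hd
  simp at hd

theorem OrderGE.add (hf : OrderGE P D f) (hg : OrderGE P D g) : OrderGE P D (f + g) := by
  intro d hd
  classical
  rcases Finset.mem_union.1 (MvPolynomial.support_add hd) with h | h
  exacts [hf d h, hg d h]

theorem OrderGE.sum {ι : Type*} {S : Finset ι} {F : ι → MixedPoly n}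
    (hF : ∀ i ∈ S, OrderGE P D (F i)) : OrderGE P D (∑ i ∈ S, F i) :=
  Finset.sum_induction F (OrderGE P D) (fun _ _ => OrderGE.add) OrderGE.zero hF

theorem OrderGE.mul (hf : OrderGE P D f) (hg : OrderGE P E g) : OrderGE P (D + E) (f * g) := by
  intro d hd
  classical
  obtain ⟨x, hx, y, hy, rfl⟩ := Finset.mem_add.1 (MvPolynomial.support_mul f g hd)
  rw [rdeg_eq_weight, map_add, ← rdeg_eq_weight, ← rdeg_eq_weight]
  exact add_le_add (hf x hx) (hg y hy)

theorem orderGE_of_isWeightedHomogeneous (hh : h.IsWeightedHomogeneous (radWeight P) D) :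
    OrderGE P D h := fun d hd => by
  rw [rdeg_eq_weight, hh (MvPolynomial.mem_support_iff.1 hd)]

theorem IsFace.of_isWeightedHomogeneous (hh : h.IsWeightedHomogeneous (radWeight P) D)
    (h0 : h ≠ 0) : IsFace P D h h :=
  ⟨hh, h0, by rw [sub_self]; exact OrderGE.zero⟩

theorem IsFace.orderGE (hf : IsFace P D h f) : OrderGE P D f := by
  have := (hf.orderGE_sub.mono (Nat.le_succ D)).add
    (orderGE_of_isWeightedHomogeneous hf.homogeneous)
  rwa [sub_add_cancel] at this

theorem IsFace.mul {h' f' : MixedPoly n} (hf : IsFace P D h f) (hf' : IsFace P E h' f') :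
    IsFace P (D + E) (h * h') (f * f') := by
  refine ⟨hf.homogeneous.mul hf'.homogeneous, mul_ne_zero hf.ne_zero hf'.ne_zero, ?_⟩
  have h1 := hf.orderGE_sub.mul hf'.orderGE
  have h2 := (orderGE_of_isWeightedHomogeneous hf.homogeneous).mul hf'.orderGE_sub
  have h3 : f * f' - h * h' = (f - h) * f' + h * (f' - h') := by ring
  rw [h3]
  exact (h1.mono (by omega)).add (h2.mono (by omega))

theorem coeff_faceFunction (P : Fin n → ℕ) (f : MixedPoly n) (d : (Fin n ⊕ Fin n) →₀ ℕ) :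
    (faceFunction P f).coeff d =
      open Classical in if d ∈ f.support ∧ ∀ e ∈ f.support, rdeg P d ≤ rdeg P e
        then f.coeff d else 0 := by
  classical
  rw [faceFunction, MvPolynomial.coeff_sum]
  simp only [MvPolynomial.coeff_monomial]
  rw [Finset.sum_ite_eq']
  simp only [Finset.mem_filter]

theorem support_faceFunction_subset (P : Fin n → ℕ) (f : MixedPoly n) :
    (faceFunction P f).support ⊆ f.support := by
  intro d hd
  rw [MvPolynomial.mem_support_iff, coeff_faceFunction] at hd
  split_ifs at hd with h
  · exact h.1
  · exact absurd rfl hd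

theorem IsFace.faceFunction_eq (hf : IsFace P D h f) : faceFunction P f = h := by
  have hmin := hf.orderGE
  -- the coefficients of `h` and `f` agree in degree `D`
  have hco : ∀ d, rdeg P d = D → f.coeff d = h.coeff d := by
    intro d hd
    by_contra hne
    have := hf.orderGE_sub d (MvPolynomial.mem_support_iff.2 (by
      rw [MvPolynomial.coeff_sub]
      exact sub_ne_zero.2 hne))
    omega
  obtain ⟨e, he⟩ := MvPolynomial.ne_zero_iff.1 hf.ne_zero
  have heD : rdeg P e = D := by rw [rdeg_eq_weight]; exact hf.homogeneous he
  have hef : e ∈ f.support := MvPolynomial.mem_support_iff.2 (by rwa [hco e heD])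
  ext d
  rw [coeff_faceFunction]
  split_ifs with hd
  · have : rdeg P d = D := le_antisymm (heD ▸ hd.2 e hef) (hmin d hd.1)
    exact hco d this
  · by_contra hne
    have hdh : h.coeff d ≠ 0 := fun h => hne h.symm
    have hdD : rdeg P d = D := by rw [rdeg_eq_weight]; exact hf.homogeneous hdh
    refine hd ⟨MvPolynomial.mem_support_iff.2 (by rwa [hco d hdD]), fun x hx => ?_⟩
    rw [hdD]
    exact hmin x hx

theorem exists_isFace_faceFunction (P : Fin n → ℕ) (hf : f ≠ 0) :
    ∃ D, IsFace P D (faceFunction P f) f := by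
  obtain ⟨e, he, hmin⟩ := f.support.exists_min_image (rdeg P)
    (Finset.nonempty_iff_ne_empty.2 (by rwa [Ne, MvPolynomial.support_eq_empty]))
  refine ⟨rdeg P e, ?_, ?_, ?_⟩
  · intro d hd
    rw [coeff_faceFunction] at hd
    split_ifs at hd with h
    · rw [← rdeg_eq_weight]
      exact le_antisymm (h.2 e he) (hmin d h.1)
    · exact absurd rfl hd
  · refine MvPolynomial.ne_zero_iff.2 ⟨e, ?_⟩
    rw [coeff_faceFunction, if_pos ⟨he, hmin⟩]
    exact MvPolynomial.mem_support_iff.1 he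
  · intro d hd
    rw [MvPolynomial.mem_support_iff, MvPolynomial.coeff_sub, coeff_faceFunction] at hd
    split_ifs at hd with h
    · exact absurd (sub_self _) hd
    · rw [sub_zero, ← MvPolynomial.mem_support_iff] at hd
      refine lt_of_le_of_ne (hmin d hd) fun heq => h ⟨hd, fun x hx => ?_⟩
      exact heq ▸ hmin x hx

end MixedPoly

namespace MixedPoly

/-! ### The mixed polynomial `p_{a,k}` -/

/-- The mixed polynomial in `v` that restricts to `r ^ (2e) * trigEval c (2t)` at `v = r e^{it}`:
the frequency `n` contributes `v^{e+n} v̄^{e-n}`, which requires `|n| ≤ e`. -/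
noncomputable def trigMixedPoly (c : ℤ →₀ ℂ) (e : ℕ) : MixedPoly 2 :=
  ∑ n ∈ c.support, MvPolynomial.C (c n) *
    (MvPolynomial.X (Sum.inl 1) ^ (e + n).toNat * MvPolynomial.X (Sum.inr 1) ^ (e - n).toNat)

theorem trigMixedPoly_isWeightedHomogeneous {c : ℤ →₀ ℂ} {e : ℕ}
    (h : ∀ n ∈ c.support, n.natAbs ≤ e) (P : Fin 2 → ℕ) :
    (trigMixedPoly c e).IsWeightedHomogeneous (radWeight P) (2 * e * P 1) := by
  refine MvPolynomial.IsWeightedHomogeneous.sum _ _ _ fun n hn => ?_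
  have h1 := ((MvPolynomial.isWeightedHomogeneous_X ℂ (radWeight P) (Sum.inl 1)).pow
    (e + n).toNat).mul ((MvPolynomial.isWeightedHomogeneous_X ℂ (radWeight P) (Sum.inr 1)).pow
    (e - n).toNat)
  have h2 := h1.C_mul (c n)
  convert h2 using 1
  simp only [radWeight, Sum.elim_inl, Sum.elim_inr, smul_eq_mul, ← add_mul]
  have := h n hn
  congr 1
  omega

theorem toFun_trigMixedPoly {c : ℤ →₀ ℂ} {e : ℕ} (h : ∀ n ∈ c.support, n.natAbs ≤ e)
    (u : ℂ) (r t : ℝ) :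
    (trigMixedPoly c e).toFun ![u, r * Complex.exp (t * Complex.I)] =
      (r : ℂ) ^ (2 * e) * trigEval c (2 * t) := by
  simp only [toFun, trigMixedPoly, map_sum, map_mul, MvPolynomial.eval_C, map_pow,
    MvPolynomial.eval_X, Sum.elim_inl, Sum.elim_inr, Matrix.cons_val_one, Matrix.cons_val_zero,
    trigEval, Finsupp.sum, Finset.mul_sum]
  refine Finset.sum_congr rfl fun n hn => ?_
  have h1 := h n hn
  have hp : ((e + n).toNat : ℤ) = e + n := Int.toNat_of_nonneg (by omega)
  have hm : ((e - n).toNat : ℤ) = e - n := Int.toNat_of_nonneg (by omega)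
  have hp' : ((e + n).toNat : ℂ) = e + n := by exact_mod_cast congrArg (Int.cast : ℤ → ℂ) hp
  have hm' : ((e - n).toNat : ℂ) = e - n := by exact_mod_cast congrArg (Int.cast : ℤ → ℂ) hm
  have he : 2 * e = (e + n).toNat + (e - n).toNat := by omega
  have hconj : conj (Complex.exp (t * Complex.I)) = Complex.exp (-(t * Complex.I)) := by
    rw [← Complex.exp_conj]
    simp
  rw [hconj, Complex.conj_ofReal, mul_pow, mul_pow, ← Complex.exp_nat_mul, ← Complex.exp_nat_mul,
    he, pow_add, hp', hm']
  have : Complex.exp (n * ((2 * t : ℝ) : ℂ) * Complex.I) =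
      Complex.exp ((e + n) * (t * Complex.I)) * Complex.exp ((e - n) * -(t * Complex.I)) := by
    rw [← Complex.exp_add]
    congr 1
    push_cast
    ring
  rw [this]
  ring

theorem trigMixedPoly_single_zero : trigMixedPoly (Finsupp.single 0 1) 0 = 1 := by
  simp [trigMixedPoly, Finsupp.support_single]

/-- The mixed polynomial `∑ u^j |v|^{2k(s-j)} b_j`, where `b_j(t) = trigEval (d j) (2t)` and
`t = arg v`. -/
noncomputable def rescaledPoly (s : ℕ) (d : ℕ → (ℤ →₀ ℂ)) (k : ℕ) : MixedPoly 2 :=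
  ∑ j ∈ Finset.range (s + 1),
    trigMixedPoly (d j) (k * (s - j)) * MvPolynomial.X (Sum.inl 0) ^ j

theorem toFun_rescaledPoly {s : ℕ} {d : ℕ → (ℤ →₀ ℂ)} {k : ℕ}
    (hk : ∀ j ∈ Finset.range (s + 1), ∀ n ∈ (d j).support, n.natAbs ≤ k * (s - j))
    (w : ℂ) (r t : ℝ) :
    (rescaledPoly s d k).toFun ![(r : ℂ) ^ (2 * k) * w, r * Complex.exp (t * Complex.I)] =
      (r : ℂ) ^ (2 * k * s) *
        ∑ j ∈ Finset.range (s + 1), trigEval (d j) (2 * t) * w ^ j := by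
  have h : ∀ j ∈ Finset.range (s + 1), _ := fun j hj =>
    toFun_trigMixedPoly (hk j hj) ((r : ℂ) ^ (2 * k) * w) r t
  rw [toFun]
  simp only [rescaledPoly, map_sum, map_mul, map_pow, MvPolynomial.eval_X, Sum.elim_inl,
    Matrix.cons_val_zero, Finset.mul_sum]
  refine Finset.sum_congr rfl fun j hj => ?_
  have h' := h j hj
  rw [toFun] at h'
  rw [h', mul_pow, ← pow_mul]
  have he : 2 * k * s = 2 * (k * (s - j)) + 2 * k * j := by
    obtain ⟨i, rfl⟩ : ∃ i, s = j + i := ⟨s - j, by have := Finset.mem_range.1 hj; omega⟩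
    rw [Nat.add_sub_cancel_left]
    ring
  rw [he, pow_add]
  ring

theorem ne_zero_of_toFun_ne_zero {n : ℕ} {f : MixedPoly n} {z : Fin n → ℂ}
    (h : f.toFun z ≠ 0) : f ≠ 0 := by
  rintro rfl
  simp [toFun] at h

section Faces

variable {s : ℕ} {d : ℕ → (ℤ →₀ ℂ)} {k : ℕ} {P : Fin 2 → ℕ}

theorem rescaledPoly_term_isWeightedHomogeneous
    (hk : ∀ j ∈ Finset.range (s + 1), ∀ n ∈ (d j).support, n.natAbs ≤ k * (s - j))
    {j : ℕ} (hj : j ∈ Finset.range (s + 1)) :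
    (trigMixedPoly (d j) (k * (s - j)) *
      (MvPolynomial.X (Sum.inl 0) : MixedPoly 2) ^ j).IsWeightedHomogeneous (radWeight P)
      (2 * k * P 1 * (s - j) + j * P 0) := by
  have h1 := (trigMixedPoly_isWeightedHomogeneous (hk j hj) P).mul
    ((MvPolynomial.isWeightedHomogeneous_X ℂ (radWeight P) (Sum.inl 0)).pow j)
  convert h1 using 1
  simp only [radWeight, Sum.elim_inl, smul_eq_mul]
  ring

theorem isFace_rescaledPoly_of_lt (hds : d s = Finsupp.single 0 1)
    (hk : ∀ j ∈ Finset.range (s + 1), ∀ n ∈ (d j).support, n.natAbs ≤ k * (s - j))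
    (hP : P 0 < 2 * k * P 1) :
    IsFace P (s * P 0) (MvPolynomial.X (Sum.inl 0) ^ s) (rescaledPoly s d k) := by
  refine ⟨?_, pow_ne_zero _ (MvPolynomial.X_ne_zero _), ?_⟩
  · exact (MvPolynomial.isWeightedHomogeneous_X ℂ (radWeight P) (Sum.inl 0)).pow s
  · rw [rescaledPoly, Finset.sum_range_succ, hds, Nat.sub_self, mul_zero,
      trigMixedPoly_single_zero, one_mul, add_sub_cancel_right]
    refine OrderGE.sum fun j hj => ?_
    have hj' := Finset.mem_range.1 hj
    refine (orderGE_of_isWeightedHomogeneous (rescaledPoly_term_isWeightedHomogeneous hk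
      (Finset.mem_range.2 (by omega)))).mono ?_
    obtain ⟨i, rfl⟩ : ∃ i, s = j + (i + 1) := ⟨s - j - 1, by omega⟩
    rw [Nat.add_sub_cancel_left]
    nlinarith

theorem isFace_rescaledPoly_of_eq
    (hk : ∀ j ∈ Finset.range (s + 1), ∀ n ∈ (d j).support, n.natAbs ≤ k * (s - j))
    (h0 : rescaledPoly s d k ≠ 0) (hP : P 0 = 2 * k * P 1) :
    IsFace P (s * P 0) (rescaledPoly s d k) (rescaledPoly s d k) := by
  refine IsFace.of_isWeightedHomogeneous ?_ h0
  refine MvPolynomial.IsWeightedHomogeneous.sum _ _ _ fun j hj => ?_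
  convert rescaledPoly_term_isWeightedHomogeneous hk hj using 1
  rw [← hP, mul_comm (P 0), ← add_mul, Nat.sub_add_cancel]
  have := Finset.mem_range.1 hj
  omega

theorem isFace_rescaledPoly_of_gt
    (hk : ∀ j ∈ Finset.range (s + 1), ∀ n ∈ (d j).support, n.natAbs ≤ k * (s - j))
    (h0 : trigMixedPoly (d 0) (k * s) ≠ 0) (hP : 2 * k * P 1 < P 0) :
    IsFace P (2 * (k * s) * P 1) (trigMixedPoly (d 0) (k * s)) (rescaledPoly s d k) := by
  refine ⟨trigMixedPoly_isWeightedHomogeneous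
    (by simpa using hk 0 (Finset.mem_range.2 (by omega))) P, h0, ?_⟩
  rw [rescaledPoly, Finset.sum_range_succ', Nat.sub_zero, pow_zero, mul_one,
    add_sub_cancel_right]
  refine OrderGE.sum fun j hj => ?_
  have hj' := Finset.mem_range.1 hj
  refine (orderGE_of_isWeightedHomogeneous (rescaledPoly_term_isWeightedHomogeneous hk
    (j := j + 1) (Finset.mem_range.2 (by omega)))).mono ?_
  obtain ⟨i, rfl⟩ : ∃ i, s = j + 1 + i := ⟨s - (j + 1), by omega⟩
  rw [Nat.add_sub_cancel_left]
  nlinarith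

end Faces

/-! ### The holomorphic factor -/

/-- If `u` is heavy enough compared with `v`, the face of `q` is the lowest term `c v^N` of
`θ_0`. -/
theorem monicInU_isFace {P : Fin 2 → ℕ} {m N : ℕ} (hm : 0 < m) {θ : Fin m → Polynomial ℂ}
    (hN : (θ ⟨0, hm⟩).trailingDegree = (N : ℕ∞)) (hP1 : 0 < P 1) (hP : N * P 1 < P 0) :
    IsFace P (N * P 1) (MvPolynomial.C ((θ ⟨0, hm⟩).coeff N) * MvPolynomial.X (Sum.inl 1) ^ N)
      (monicInU m θ) := by
  have hpow : ∀ i l, OrderGE P (l * radWeight P i) ((MvPolynomial.X i : MixedPoly 2) ^ l) :=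
    fun i l => orderGE_of_isWeightedHomogeneous
      ((MvPolynomial.isWeightedHomogeneous_X ℂ (radWeight P) i).pow l)
  have hge : ∀ f : MixedPoly 2, OrderGE P 0 f := fun f d _ => Nat.zero_le _
  have hlow : ∀ i < N, (θ ⟨0, hm⟩).coeff i = 0 := fun i hi =>
    Polynomial.coeff_eq_zero_of_lt_trailingDegree (by rw [hN]; exact_mod_cast hi)
  have hc : (θ ⟨0, hm⟩).coeff N ≠ 0 := by
    have h0 : θ ⟨0, hm⟩ ≠ 0 := by
      intro h
      rw [h, Polynomial.trailingDegree_zero] at hN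
      exact absurd hN (by simp)
    rw [Polynomial.trailingDegree_eq_iff_natTrailingDegree_eq h0] at hN
    rw [← hN]
    exact Polynomial.trailingCoeff_nonzero_iff_nonzero.2 h0
  refine ⟨?_, ?_, ?_⟩
  · exact ((MvPolynomial.isWeightedHomogeneous_X ℂ (radWeight P) (Sum.inl 1)).pow N).C_mul _
  · exact mul_ne_zero (by simpa using hc) (pow_ne_zero _ (MvPolynomial.X_ne_zero _))
  · obtain ⟨m, rfl⟩ : ∃ l, m = l + 1 := ⟨m - 1, by omega⟩
    have hdvd : Polynomial.X ^ (N + 1) ∣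
        θ 0 - Polynomial.C ((θ 0).coeff N) * Polynomial.X ^ N := by
      rw [Polynomial.X_pow_dvd_iff]
      intro i hi
      rw [Polynomial.coeff_sub, Polynomial.coeff_C_mul_X_pow]
      split_ifs with h
      · rw [h, sub_self]
      · rw [sub_zero]
        exact hlow i (by omega)
    obtain ⟨η, hη⟩ := hdvd
    have hθ : θ 0 = Polynomial.C ((θ 0).coeff N) * Polynomial.X ^ N +
        Polynomial.X ^ (N + 1) * η := by
      rw [← hη]; ring
    have heq : monicInU (m + 1) θ -
        MvPolynomial.C ((θ 0).coeff N) * MvPolynomial.X (Sum.inl 1) ^ N =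
        MvPolynomial.X (Sum.inl 0) ^ (m + 1) +
        MvPolynomial.X (Sum.inl 1) ^ (N + 1) *
          Polynomial.aeval (MvPolynomial.X (Sum.inl 1) : MixedPoly 2) η +
        ∑ j : Fin m, Polynomial.aeval (MvPolynomial.X (Sum.inl 1) : MixedPoly 2) (θ j.succ) *
          MvPolynomial.X (Sum.inl 0) ^ ((j : ℕ) + 1) := by
      have h0 : Polynomial.aeval (MvPolynomial.X (Sum.inl 1) : MixedPoly 2) (θ 0) =
          MvPolynomial.C ((θ 0).coeff N) * MvPolynomial.X (Sum.inl 1) ^ N +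
          MvPolynomial.X (Sum.inl 1) ^ (N + 1) *
            Polynomial.aeval (MvPolynomial.X (Sum.inl 1) : MixedPoly 2) η := by
        conv_lhs => rw [hθ]
        simp [MvPolynomial.algebraMap_eq]
      rw [monicInU, Fin.sum_univ_succ, h0]
      simp only [Fin.val_zero, pow_zero, mul_one, Fin.val_succ]
      ring
    change OrderGE P _ (monicInU (m + 1) θ -
        MvPolynomial.C ((θ 0).coeff N) * MvPolynomial.X (Sum.inl 1) ^ N)
    have hw0 : radWeight P (Sum.inl 0) = P 0 := rfl
    have hw1 : radWeight P (Sum.inl 1) = P 1 := rfl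
    rw [heq]
    refine ((hpow _ _).mono ?_).add (((hpow _ _).mul (hge _)).mono ?_) |>.add
      (OrderGE.sum fun j _ => ((hge _).mul (hpow _ _)).mono ?_)
    · rw [hw0]; nlinarith
    · rw [hw1]; nlinarith [hP1]
    · rw [hw0]; nlinarith

end MixedPoly

namespace MixedPoly

/-! ### Critical points -/

theorem differentiable_toFun {n : ℕ} (f : MixedPoly n) : Differentiable ℝ f.toFun := by
  have hc : ∀ i, Differentiable ℝ fun z : Fin n → ℂ => conj (z i) := fun i =>
    Complex.conjCLE.differentiable.comp (differentiable_apply i)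
  unfold toFun
  simp only [MvPolynomial.eval_eq', Fintype.prod_sum_type, Sum.elim_inl, Sum.elim_inr]
  fun_prop

theorem toFun_mul {n : ℕ} (f g : MixedPoly n) (z : Fin n → ℂ) :
    (f * g).toFun z = f.toFun z * g.toFun z :=
  map_mul _ _ _

/-- Derivatives along curves belong to the range of the differential. -/
theorem mem_range_fderiv_of_curve {n : ℕ} (f : MixedPoly n) {γ : ℝ → Fin n → ℂ} {τ : ℝ}
    (hγ : DifferentiableAt ℝ γ τ) {y : ℂ} (hy : HasDerivAt (fun x => f.toFun (γ x)) y τ) :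
    y ∈ (fderiv ℝ f.toFun (γ τ)).range := by
  have h := (f.differentiable_toFun (γ τ)).hasFDerivAt.comp_hasDerivAt τ hγ.hasDerivAt
  exact ⟨_, h.unique hy⟩

/-- Two complex numbers with nonreal quotient span `ℂ` over `ℝ`. -/
theorem eq_top_of_mem_of_mul_mem {V : Submodule ℝ ℂ} {β ξ : ℂ} (hβ : β ≠ 0) (h1 : β ∈ V)
    (h2 : β * ξ ∈ V) (hξ : ξ.im ≠ 0) : V = ⊤ := by
  refine eq_top_iff.2 fun y _ => ?_
  have h3 := V.add_mem (V.smul_mem ((y / β).re - (y / β).im / ξ.im * ξ.re) h1)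
    (V.smul_mem ((y / β).im / ξ.im) h2)
  have h4 : (((y / β).re - (y / β).im / ξ.im * ξ.re : ℝ) : ℂ) +
      (((y / β).im / ξ.im : ℝ) : ℂ) * ξ = y / β := by
    apply Complex.ext
    · simp
    · simp [hξ]
  convert h3 using 1
  rw [Complex.real_smul, Complex.real_smul, mul_comm _ β, mul_left_comm, ← mul_add, h4]
  field_simp

/-- In the coordinates `(w, r, t)` with `u = r^{2k} w` and `v = r e^{it}`, a function
`c r^M e^{iNt} G(w, t)` that is holomorphic in `w` is regular where `G_w ≠ 0`. Where `G ≠ 0`, the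
radial derivative is a nonzero real multiple of the value and the angular derivative is the value
times `iN + G_t / G`, so that these two are independent if `|G_t| < N |G|`. -/
theorem not_isCritical_of_polar {f : MixedPoly 2} {G : ℂ → ℝ → ℂ} {c : ℂ} (hc : c ≠ 0)
    {N M k : ℕ} (hNM : N ≤ M)
    (hf : ∀ (w : ℂ) (r t : ℝ), f.toFun ![(r : ℂ) ^ (2 * k) * w, r * Complex.exp (t * Complex.I)] =
      c * ((r : ℂ) ^ M * Complex.exp (N * (t * Complex.I))) * G w t)
    {w : ℂ} {r t : ℝ} (hr : 0 < r) {Gt Gw : ℂ} (hGt : HasDerivAt (G w) Gt t)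
    (hGw : HasDerivAt (fun x => G x t) Gw w)
    (h : Gw ≠ 0 ∨ G w t ≠ 0 ∧ ‖Gt‖ < N * ‖G w t‖) :
    ¬ IsCritical f ![(r : ℂ) ^ (2 * k) * w, r * Complex.exp (t * Complex.I)] := by
  rw [IsCritical, not_not]
  set z : Fin 2 → ℂ := ![(r : ℂ) ^ (2 * k) * w, r * Complex.exp (t * Complex.I)] with hz
  suffices (fderiv ℝ f.toFun z).range = ⊤ from LinearMap.range_eq_top.1 this
  have hr' : (r : ℂ) ≠ 0 := by exact_mod_cast hr.ne'
  set E := Complex.exp (N * (t * Complex.I)) with hE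
  have hE0 : E ≠ 0 := Complex.exp_ne_zero _
  rcases h with hw | ⟨hG, hlt⟩
  · -- the derivatives in the direction `η` of the first coordinate
    have hη : ∀ η : ℂ, c * ((r : ℂ) ^ M * E) * (Gw * η) ∈ (fderiv ℝ f.toFun z).range := by
      intro η
      have hl : HasDerivAt (fun x : ℝ => w + x * η) η 0 := by
        simpa using ((Complex.ofRealCLM.hasDerivAt (x := 0)).mul_const η).const_add w
      have hγ : DifferentiableAt ℝ (fun x : ℝ => (![(r : ℂ) ^ (2 * k) * (w + x * η),
          r * Complex.exp (t * Complex.I)] : Fin 2 → ℂ)) 0 := by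
        rw [differentiableAt_pi]
        intro i
        fin_cases i
        · exact hl.differentiableAt.const_mul _
        · exact differentiableAt_const _
      have hd : HasDerivAt (fun x : ℝ => f.toFun ![(r : ℂ) ^ (2 * k) * (w + x * η),
          r * Complex.exp (t * Complex.I)]) (c * ((r : ℂ) ^ M * E) * (Gw * η)) 0 := by
        simp only [hf]
        refine HasDerivAt.const_mul _ ?_
        refine HasDerivAt.comp (h := fun x : ℝ => w + x * η) (h₂ := fun x => G x t) (0 : ℝ) ?_ hl
        simpa using hGw
      have := mem_range_fderiv_of_curve f hγ hd
      simpa [hz] using this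
    refine eq_top_of_mem_of_mul_mem (β := c * ((r : ℂ) ^ M * E) * Gw) (ξ := Complex.I) ?_ ?_ ?_ ?_
    · exact mul_ne_zero (mul_ne_zero hc (mul_ne_zero (pow_ne_zero _ hr') hE0)) hw
    · simpa using hη 1
    · simpa [mul_assoc] using hη Complex.I
    · simp
  · have hN : 0 < N := by
      rcases Nat.eq_zero_or_pos N with rfl | hN
      · exact absurd hlt (by simp)
      · exact hN
    have hrad : c * ((M * (r : ℂ) ^ (M - 1)) * E) * G w t ∈ (fderiv ℝ f.toFun z).range := by
      have hid : HasDerivAt (fun x : ℝ => (x : ℂ)) 1 r := Complex.ofRealCLM.hasDerivAt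
      refine mem_range_fderiv_of_curve f (γ := fun x : ℝ => ![(x : ℂ) ^ (2 * k) * w,
        x * Complex.exp (t * Complex.I)]) (τ := r) ?_ ?_
      · rw [differentiableAt_pi]
        intro i
        fin_cases i
        · exact (hid.differentiableAt.pow _).mul_const _
        · exact hid.differentiableAt.mul_const _
      · simp only [hf]
        have := (hid.pow M).mul_const E |>.const_mul c |>.mul_const (G w t)
        simpa using this
    have hang : c * ((r : ℂ) ^ M * E) * (N * Complex.I * G w t + Gt) ∈
        (fderiv ℝ f.toFun z).range := by
      have hid : HasDerivAt (fun x : ℝ => (x : ℂ) * Complex.I) Complex.I t := by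
        simpa using (Complex.ofRealCLM.hasDerivAt (x := t)).mul_const Complex.I
      refine mem_range_fderiv_of_curve f (γ := fun x : ℝ => ![(r : ℂ) ^ (2 * k) * w,
        r * Complex.exp (x * Complex.I)]) (τ := t) ?_ ?_
      · rw [differentiableAt_pi]
        intro i
        fin_cases i
        · exact differentiableAt_const _
        · exact hid.differentiableAt.cexp.const_mul _
      · simp only [hf]
        refine (((((hid.const_mul (N : ℂ)).cexp).const_mul ((r : ℂ) ^ M)).const_mul c).fun_mul
          hGt).congr_deriv ?_
        rw [hE]
        ring
    have hM : (0 : ℝ) < M := by exact_mod_cast hN.trans_le hNM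
    refine eq_top_of_mem_of_mul_mem (β := c * ((r : ℂ) ^ M * E) * G w t)
      (ξ := N * Complex.I + Gt / G w t) ?_ ?_ ?_ ?_
    · exact mul_ne_zero (mul_ne_zero hc (mul_ne_zero (pow_ne_zero _ hr') hE0)) hG
    · convert Submodule.smul_mem _ (r / M : ℝ) hrad using 1
      have hM' : (M : ℂ) ≠ 0 := by exact_mod_cast hM.ne'
      obtain ⟨l, rfl⟩ : ∃ l, M = l + 1 := ⟨M - 1, by omega⟩
      rw [Complex.real_smul, Nat.add_sub_cancel]
      push_cast at hM' ⊢
      field_simp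
      ring
    · convert hang using 1
      field_simp
    · have h1 : |(Gt / G w t).im| < N := by
        refine (Complex.abs_im_le_norm _).trans_lt ?_
        rwa [norm_div, div_lt_iff₀ (norm_pos_iff.2 hG)]
      have h2 : (N * Complex.I + Gt / G w t).im = N + (Gt / G w t).im := by simp
      rw [h2]
      have := (abs_lt.1 h1).1
      linarith

/-! ### Holomorphic weighted homogeneous polynomials -/

/-- No conjugate variable occurs in `f`. -/
def IsHolomorphic {n : ℕ} (f : MixedPoly n) : Prop :=
  ∀ d ∈ f.support, ∀ i, d (Sum.inr i) = 0

theorem IsHolomorphic.toFun_eq {n : ℕ} {f : MixedPoly n} (hf : f.IsHolomorphic) (z : Fin n → ℂ) :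
    f.toFun z = ∑ d ∈ f.support, f.coeff d * ∏ i, z i ^ d (Sum.inl i) := by
  rw [toFun, MvPolynomial.eval_eq']
  refine Finset.sum_congr rfl fun d hd => ?_
  rw [Fintype.prod_sum_type]
  simp [hf d hd]

theorem IsHolomorphic.differentiable {n : ℕ} {f : MixedPoly n} (hf : f.IsHolomorphic) :
    Differentiable ℂ f.toFun := by
  rw [funext hf.toFun_eq]
  fun_prop

theorem IsHolomorphic.mul {n : ℕ} {f g : MixedPoly n} (hf : f.IsHolomorphic)
    (hg : g.IsHolomorphic) : (f * g).IsHolomorphic := by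
  classical
  intro d hd i
  obtain ⟨x, hx, y, hy, rfl⟩ := Finset.mem_add.1 (MvPolynomial.support_mul f g hd)
  simp [hf x hx i, hg y hy i]

theorem IsHolomorphic.add {n : ℕ} {f g : MixedPoly n} (hf : f.IsHolomorphic)
    (hg : g.IsHolomorphic) : (f + g).IsHolomorphic := by
  classical
  intro d hd i
  rcases Finset.mem_union.1 (MvPolynomial.support_add hd) with h | h
  exacts [hf d h i, hg d h i]

theorem isHolomorphic_C {n : ℕ} (c : ℂ) : IsHolomorphic (MvPolynomial.C c : MixedPoly n) := by
  classical
  intro d hd i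
  rw [MvPolynomial.mem_support_iff, MvPolynomial.coeff_C] at hd
  split_ifs at hd with h
  · simp [← h]
  · exact absurd rfl hd

theorem isHolomorphic_X {n : ℕ} (i : Fin n) :
    IsHolomorphic (MvPolynomial.X (Sum.inl i) : MixedPoly n) := by
  intro d hd j
  rw [MvPolynomial.support_X, Finset.mem_singleton] at hd
  simp [hd]

theorem IsHolomorphic.pow {n : ℕ} {f : MixedPoly n} (hf : f.IsHolomorphic) (l : ℕ) :
    (f ^ l).IsHolomorphic := by
  induction l with
  | zero => simpa using isHolomorphic_C 1
  | succ l ih => rw [pow_succ]; exact ih.mul hf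

theorem IsHolomorphic.sum {n : ℕ} {ι : Type*} {S : Finset ι} {F : ι → MixedPoly n}
    (hF : ∀ i ∈ S, (F i).IsHolomorphic) : (∑ i ∈ S, F i).IsHolomorphic :=
  Finset.sum_induction F IsHolomorphic (fun _ _ => IsHolomorphic.add)
    (by simpa using isHolomorphic_C 0) hF

theorem isHolomorphic_monicInU (m : ℕ) (θ : Fin m → Polynomial ℂ) :
    (monicInU m θ).IsHolomorphic := by
  refine ((isHolomorphic_X 0).pow m).add (IsHolomorphic.sum fun j _ => ?_)
  refine IsHolomorphic.mul ?_ ((isHolomorphic_X 0).pow _)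
  rw [Polynomial.aeval_eq_sum_range]
  refine IsHolomorphic.sum fun i _ => ?_
  rw [MvPolynomial.smul_eq_C_mul]
  exact (isHolomorphic_C _).mul ((isHolomorphic_X 1).pow _)

theorem IsHolomorphic.faceFunction {n : ℕ} {f : MixedPoly n} (hf : f.IsHolomorphic)
    (P : Fin n → ℕ) : (faceFunction P f).IsHolomorphic :=
  fun d hd => hf d (support_faceFunction_subset P f hd)

/-- By the Euler identity, a weighted homogeneous holomorphic polynomial of positive degree has no
critical points outside of its zero set. -/
theorem IsHolomorphic.not_isCritical_of_toFun_ne_zero {n : ℕ} {f : MixedPoly n}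
    (hf : f.IsHolomorphic) {P : Fin n → ℕ} {D : ℕ} (hD : 0 < D)
    (hh : f.IsWeightedHomogeneous (radWeight P) D) {z : Fin n → ℂ} (hz : f.toFun z ≠ 0) :
    ¬ IsCritical f z := by
  rw [IsCritical, not_not]
  have hscale : ∀ x : ℂ, f.toFun (fun i => x ^ P i * z i) = x ^ D * f.toFun z := by
    intro x
    rw [hf.toFun_eq, hf.toFun_eq, Finset.mul_sum]
    refine Finset.sum_congr rfl fun d hd => ?_
    have h1 : ∑ i, P i * d (Sum.inl i) = D := by
      rw [← hh (MvPolynomial.mem_support_iff.1 hd), ← rdeg_eq_weight, rdeg]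
      simp [radExp, hf d hd]
    simp only [mul_pow, Finset.prod_mul_distrib, ← pow_mul, Finset.prod_pow_eq_pow_sum, h1]
    ring
  have hγ : DifferentiableAt ℂ (fun (x : ℂ) i => x ^ P i * z i) 1 := by fun_prop
  have hγ1 : (fun i => (1 : ℂ) ^ P i * z i) = z := by simp
  have h1 := (hf.differentiable _).hasFDerivAt.comp_hasDerivAt (1 : ℂ) hγ.hasDerivAt
  have h2 : HasDerivAt (fun x : ℂ => x ^ D * f.toFun z) (D * f.toFun z) 1 := by
    simpa using (hasDerivAt_pow D (1 : ℂ)).mul_const (f.toFun z)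
  have h3 := h1.unique (h2.congr_of_eventuallyEq (Filter.Eventually.of_forall hscale))
  rw [hγ1] at h3
  rw [(hf.differentiable z).fderiv_restrictScalars ℝ]
  have hne : (D : ℂ) * f.toFun z ≠ 0 := mul_ne_zero (by exact_mod_cast hD.ne') hz
  intro y
  refine ⟨(y / (D * f.toFun z)) • deriv (fun (x : ℂ) i => x ^ P i * z i) 1, ?_⟩
  rw [ContinuousLinearMap.coe_restrictScalars', map_smul, h3, smul_eq_mul, div_mul_cancel₀ _ hne]

theorem not_isCritical_mul_of_toFun_eq_zero {n : ℕ} {f g : MixedPoly n} {z : Fin n → ℂ}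
    (hf : f.toFun z ≠ 0) (hg : g.toFun z = 0) (h : ¬ IsCritical g z) :
    ¬ IsCritical (f * g) z := by
  rw [IsCritical, not_not] at *
  have h1 : (f * g).toFun = fun z => f.toFun z * g.toFun z := funext (toFun_mul f g)
  rw [h1, fderiv_fun_mul (f.differentiable_toFun z) (g.differentiable_toFun z)]
  intro y
  obtain ⟨x, hx⟩ := h (y / f.toFun z)
  exact ⟨x, by simp [hx, hg, mul_div_cancel₀ _ hf]⟩

end MixedPoly

namespace MixedPoly

/-! ### Convenience -/

/-- A mixed polynomial that does not vanish identically on a coordinate axis has a monomial on the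
corresponding axis of the Newton polygon. -/
theorem convenient_of_toFun_ne_zero {n : ℕ} {f : MixedPoly n}
    (h : ∀ j, ∃ z : Fin n → ℂ, (∀ i, i ≠ j → z i = 0) ∧ f.toFun z ≠ 0) : f.Convenient := by
  intro j
  obtain ⟨z, hz, hf⟩ := h j
  rw [toFun, MvPolynomial.eval_eq'] at hf
  obtain ⟨d, hd, hne⟩ := Finset.exists_ne_zero_of_sum_ne_zero hf
  have hprod := Finset.prod_ne_zero_iff.1 (right_ne_zero_of_mul hne)
  refine ⟨fun i => radExp d i, subset_convexHull ℝ _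
    (Set.mem_iUnion₂.2 ⟨d, hd, fun i => le_rfl⟩), fun i hi => ?_⟩
  have hl : d (Sum.inl i) = 0 := by
    by_contra h0
    exact hprod (Sum.inl i) (Finset.mem_univ _) (by simp [hz i hi, h0])
  have hr : d (Sum.inr i) = 0 := by
    by_contra h0
    exact hprod (Sum.inr i) (Finset.mem_univ _) (by simp [hz i hi, h0])
  simp [radExp, hl, hr]

theorem toFun_monicInU (m : ℕ) (θ : Fin m → Polynomial ℂ) (z : Fin 2 → ℂ) :
    (monicInU m θ).toFun z = z 0 ^ m + ∑ j : Fin m, (θ j).eval (z 1) * z 0 ^ (j : ℕ) := by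
  have h : ∀ p : Polynomial ℂ, MvPolynomial.eval (Sum.elim z fun i => conj (z i))
      (Polynomial.aeval (MvPolynomial.X (Sum.inl 1) : MixedPoly 2) p) = p.eval (z 1) := by
    intro p
    rw [← MvPolynomial.coe_aeval_eq_eval, RingHom.coe_coe, ← Polynomial.aeval_algHom_apply]
    simp
  simp [toFun, monicInU, h]

theorem toFun_rescaledPoly_of_eq_zero {s : ℕ} {d : ℕ → (ℤ →₀ ℂ)} {k : ℕ} (hk0 : 0 < k)
    (hds : d s = Finsupp.single 0 1)
    (hk : ∀ j ∈ Finset.range (s + 1), ∀ n ∈ (d j).support, n.natAbs ≤ k * (s - j)) (u : ℂ) :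
    (rescaledPoly s d k).toFun ![u, 0] = u ^ s := by
  have h : ∀ j ∈ Finset.range s, (trigMixedPoly (d j) (k * (s - j))).toFun ![u, 0] = 0 := by
    intro j hj
    have hj' := Finset.mem_range.1 hj
    have := toFun_trigMixedPoly (hk j (Finset.mem_range.2 (by omega))) u 0 0
    rw [Complex.ofReal_zero, zero_mul, zero_pow, zero_mul] at this
    · exact this
    · have : 0 < k * (s - j) := Nat.mul_pos hk0 (by omega)
      omega
  simp only [toFun] at h ⊢
  rw [rescaledPoly, Finset.sum_range_succ, hds, Nat.sub_self, mul_zero,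
    trigMixedPoly_single_zero, map_add, map_sum, Finset.sum_eq_zero]
  · simp
  · intro j hj
    rw [map_mul, h j hj, zero_mul]

theorem convenient_rescaledPoly_mul_monicInU {s : ℕ} {d : ℕ → (ℤ →₀ ℂ)} {k : ℕ} (hk0 : 0 < k)
    (hds : d s = Finsupp.single 0 1)
    (hk : ∀ j ∈ Finset.range (s + 1), ∀ n ∈ (d j).support, n.natAbs ≤ k * (s - j))
    (h0 : trigEval (d 0) 0 ≠ 0) {m : ℕ} (hm : 0 < m) {θ : Fin m → Polynomial ℂ}
    (hθ : θ ⟨0, hm⟩ ≠ 0) : (rescaledPoly s d k * monicInU m θ).Convenient := by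
  have hex : ∀ p : Polynomial ℂ, p ≠ 0 → ∃ x, x ≠ 0 ∧ p.eval x ≠ 0 := by
    intro p hp
    by_contra! hall
    refine mul_ne_zero Polynomial.X_ne_zero hp (Polynomial.funext fun x => ?_)
    by_cases hx : x = 0
    · simp [hx]
    · simp [hall x hx]
  refine convenient_of_toFun_ne_zero fun j => ?_
  fin_cases j
  · -- on the `u`-axis, `p` is `u ^ s` and `q` is monic in `u`
    let Q : Polynomial ℂ := Polynomial.X ^ m +
      ∑ j : Fin m, Polynomial.C ((θ j).eval 0) * Polynomial.X ^ (j : ℕ)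
    have hQ : Q.Monic := Polynomial.monic_X_pow_add (Polynomial.degree_sum_fin_lt _)
    obtain ⟨u, hu, hQu⟩ := hex Q hQ.ne_zero
    refine ⟨![u, 0], fun i hi => ?_, ?_⟩
    · fin_cases i
      · exact absurd rfl hi
      · rfl
    · rw [toFun_mul, toFun_rescaledPoly_of_eq_zero hk0 hds hk, toFun_monicInU]
      refine mul_ne_zero (pow_ne_zero _ hu) ?_
      simpa [Q, Polynomial.eval_finsetSum] using hQu
  · -- on the real `v`-axis, `p` is a multiple of `b_0(0)` and `q` is `θ_0`
    obtain ⟨r, hr, hpos⟩ : ∃ r : ℝ, 0 < r ∧ (θ ⟨0, hm⟩).eval (r : ℂ) ≠ 0 := by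
      by_contra! hall
      refine hθ (Polynomial.eq_zero_of_infinite_isRoot _ ?_)
      refine ((Set.Ioi_infinite (0 : ℝ)).image Complex.ofReal_injective.injOn).mono ?_
      rintro _ ⟨r, hr, rfl⟩
      exact hall r hr
    refine ⟨![0, r], fun i hi => ?_, ?_⟩
    · fin_cases i
      · rfl
      · exact absurd rfl hi
    · have h1 := toFun_rescaledPoly hk 0 r 0
      rw [Finset.sum_eq_single_of_mem 0 (Finset.mem_range.2 (by omega))
        (fun j _ hj => by simp [hj])] at h1
      simp only [mul_zero, Complex.ofReal_zero, zero_mul, Complex.exp_zero, mul_one,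
        pow_zero] at h1
      rw [toFun_mul, h1, toFun_monicInU, Finset.sum_eq_single_of_mem ⟨0, hm⟩ (Finset.mem_univ _)]
      · have hr' : (r : ℂ) ≠ 0 := by exact_mod_cast hr.ne'
        refine mul_ne_zero (mul_ne_zero (pow_ne_zero _ hr') h0) ?_
        simpa [hm.ne'] using hpos
      · intro j _ hj
        have : (j : ℕ) ≠ 0 := fun h => hj (Fin.ext h)
        simp [this]

/-! ### Strong non-degeneracy -/

theorem exists_polar {z : Fin 2 → ℂ} (hz : z 1 ≠ 0) (k : ℕ) :
    ∃ (w : ℂ) (r t : ℝ), 0 < r ∧ t ∈ Set.Icc (-Real.pi) Real.pi ∧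
      z = ![(r : ℂ) ^ (2 * k) * w, r * Complex.exp (t * Complex.I)] := by
  have hr : 0 < ‖z 1‖ := norm_pos_iff.2 hz
  have hr' : ((‖z 1‖ : ℝ) : ℂ) ≠ 0 := by exact_mod_cast hr.ne'
  refine ⟨z 0 / (‖z 1‖ : ℂ) ^ (2 * k), ‖z 1‖, (z 1).arg, hr,
    ⟨(Complex.neg_pi_lt_arg _).le, Complex.arg_le_pi _⟩, ?_⟩
  ext i
  fin_cases i
  · simp [mul_div_cancel₀ _ (pow_ne_zero _ hr')]
  · simp

/-- The three kinds of faces of `p q`: for `P₀ < 2k P₁` the face function is `u^s q_P`, which is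
holomorphic; otherwise it is a monomial in `v` times `p` or times the part of `p` that does not
depend on `u`. -/
theorem stronglyNonDegenerate_rescaledPoly_mul_monicInU {s : ℕ} (hs : 0 < s)
    {d : ℕ → (ℤ →₀ ℂ)} (hds : d s = Finsupp.single 0 1) {R : ℝ → Polynomial ℂ}
    (hR : ∀ t, R t = ∑ j ∈ Finset.range (s + 1),
      Polynomial.C (trigEval (d j) (2 * t)) * Polynomial.X ^ j)
    {k N : ℕ} (hkN : N < k)
    (hk : ∀ j ∈ Finset.range (s + 1), ∀ n ∈ (d j).support, n.natAbs ≤ k * (s - j))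
    (hlt : ∀ t ∈ Set.Icc (-Real.pi) Real.pi, ∀ w : ℂ,
      w = 0 ∨ (R t).derivative.eval w = 0 → (R t).eval w ≠ 0 ∧
        ‖∑ j ∈ Finset.range (s + 1), deriv (fun t => trigEval (d j) (2 * t)) t * w ^ j‖ <
          N * ‖(R t).eval w‖)
    {m : ℕ} (hm : 0 < m) {θ : Fin m → Polynomial ℂ}
    (hN : (θ ⟨0, hm⟩).trailingDegree = (N : ℕ∞)) (hq : (monicInU m θ).NonDegenerate) :
    (rescaledPoly s d k * monicInU m θ).StronglyNonDegenerate := by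
  have hev : ∀ w t, (R t).eval w = ∑ j ∈ Finset.range (s + 1), trigEval (d j) (2 * t) * w ^ j := by
    intro w t
    simp [hR, Polynomial.eval_finsetSum]
  have hev0 : ∀ t, (R t).eval 0 = trigEval (d 0) (2 * t) := by
    intro t
    rw [hev, Finset.sum_eq_single_of_mem 0 (Finset.mem_range.2 (by omega))
      (fun j _ hj => by simp [hj])]
    simp
  have hpi : (0 : ℝ) ∈ Set.Icc (-Real.pi) Real.pi :=
    ⟨neg_nonpos.2 Real.pi_pos.le, Real.pi_pos.le⟩
  have hb0 : trigEval (d 0) (2 * 0) ≠ 0 := by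
    rw [← hev0]
    exact (hlt 0 hpi 0 (Or.inl rfl)).1
  have hdiff : ∀ (j : ℕ) (t : ℝ), HasDerivAt (fun t => trigEval (d j) (2 * t))
      (deriv (fun t => trigEval (d j) (2 * t)) t) t := by
    intro j t
    refine DifferentiableAt.hasDerivAt ?_
    exact (((contDiff_trigEval (d j)).differentiable one_ne_zero).comp
      (differentiable_id.const_mul (2 : ℝ))) t
  have hk0 := hk 0 (Finset.mem_range.2 (by omega))
  rw [Nat.sub_zero] at hk0
  have htrig : trigMixedPoly (d 0) (k * s) ≠ 0 := by
    refine ne_zero_of_toFun_ne_zero (z := ![0, ((1 : ℝ) : ℂ) * Complex.exp ((0 : ℝ) * Complex.I)])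
      ?_
    rw [toFun_trigMixedPoly hk0]
    simpa using hb0
  have hp : rescaledPoly s d k ≠ 0 := by
    refine ne_zero_of_toFun_ne_zero
      (z := ![((1 : ℝ) : ℂ) ^ (2 * k) * 0, ((1 : ℝ) : ℂ) * Complex.exp ((0 : ℝ) * Complex.I)]) ?_
    rw [toFun_rescaledPoly hk, ← hev, hev0]
    simpa using hb0
  -- the weights `(N + 1, 1)` single out the lowest term of `θ_0`
  have hc : (θ ⟨0, hm⟩).coeff N ≠ 0 := by
    have h := (monicInU_isFace (P := ![N + 1, 1]) hm hN (by simp) (by simp)).ne_zero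
    intro h0
    simp [h0] at h
  have hmono : ∀ z : Fin 2 → ℂ, toFun (MvPolynomial.C ((θ ⟨0, hm⟩).coeff N) *
      MvPolynomial.X (Sum.inl 1) ^ N) z = (θ ⟨0, hm⟩).coeff N * z 1 ^ N := by
    intro z
    simp [toFun]
  intro P hP z hz
  have hP1 := hP 1
  have hface : 2 * k * P 1 ≤ P 0 → IsFace P (N * P 1)
      (MvPolynomial.C ((θ ⟨0, hm⟩).coeff N) * MvPolynomial.X (Sum.inl 1) ^ N)
      (monicInU m θ) := fun h => monicInU_isFace hm hN hP1 (by nlinarith)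
  rcases lt_trichotomy (P 0) (2 * k * P 1) with hlt' | heq | hgt
  · have hq0 : monicInU m θ ≠ 0 := by
      intro h
      have := (monicInU_isFace (P := ![N + 1, 1]) hm hN (by simp) (by simp)).faceFunction_eq
      rw [h] at this
      exact (monicInU_isFace (P := ![N + 1, 1]) hm hN (by simp) (by simp)).ne_zero
        (this ▸ by simp [faceFunction])
    obtain ⟨E, hE⟩ := exists_isFace_faceFunction P hq0
    have hF := (isFace_rescaledPoly_of_lt hds hk hlt').mul hE
    rw [hF.faceFunction_eq]
    have hu : toFun (MvPolynomial.X (Sum.inl 0) ^ s) z ≠ 0 := by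
      simpa [toFun] using pow_ne_zero s (hz 0)
    by_cases h0 : (faceFunction P (monicInU m θ)).toFun z = 0
    · exact not_isCritical_mul_of_toFun_eq_zero hu h0 (hq P hP z hz h0)
    · refine IsHolomorphic.not_isCritical_of_toFun_ne_zero
        (((isHolomorphic_X 0).pow s).mul ((isHolomorphic_monicInU m θ).faceFunction P))
        (Nat.add_pos_left (Nat.mul_pos hs (hP 0)) E) hF.homogeneous ?_
      rw [toFun_mul]
      exact mul_ne_zero hu h0
  · rw [((isFace_rescaledPoly_of_eq hk hp heq).mul (hface heq.ge)).faceFunction_eq]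
    obtain ⟨w, r, t, hr, ht, rfl⟩ := exists_polar (hz 1) k
    refine not_isCritical_of_polar hc (N := N) (M := N + 2 * k * s) (by omega)
      (G := fun w t => (R t).eval w) ?_ hr
      (Gt := ∑ j ∈ Finset.range (s + 1), deriv (fun t => trigEval (d j) (2 * t)) t * w ^ j)
      ?_ ((R t).hasDerivAt w) ?_
    · intro w r t
      rw [toFun_mul, hmono, toFun_rescaledPoly hk, ← hev, Matrix.cons_val_one,
        Matrix.cons_val_zero, mul_pow, ← Complex.exp_nat_mul, pow_add]
      ring
    · simp only [hev]
      exact HasDerivAt.fun_sum fun j _ => (hdiff j t).mul_const _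
    · by_cases hw : (R t).derivative.eval w = 0
      · exact Or.inr (hlt t ht w (Or.inr hw))
      · exact Or.inl hw
  · rw [((isFace_rescaledPoly_of_gt hk htrig hgt).mul (hface hgt.le)).faceFunction_eq]
    obtain ⟨w, r, t, hr, ht, rfl⟩ := exists_polar (hz 1) k
    refine not_isCritical_of_polar hc (N := N) (M := N + 2 * (k * s)) (by omega)
      (G := fun _ t => trigEval (d 0) (2 * t)) ?_ hr (hdiff 0 t) (hasDerivAt_const w _)
      (Or.inr ?_)
    · intro w r t
      rw [toFun_mul, hmono, toFun_trigMixedPoly hk0, Matrix.cons_val_one,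
        Matrix.cons_val_zero, mul_pow, ← Complex.exp_nat_mul, pow_add]
      ring
    · have h := hlt t ht 0 (Or.inl rfl)
      rw [hev0, Finset.sum_eq_single_of_mem 0 (Finset.mem_range.2 (by omega))
        (fun j _ hj => by simp [hj])] at h
      simpa using h

end MixedPoly

/-! ### The product `p_{a,k} q` -/

theorem FourierParam.isRescaled_rescaledPoly {s : ℕ} (D : FourierParam s) {a : ℝ}
    {d : ℕ → (ℤ →₀ ℂ)} (hR : ∀ t, D.rootPoly a t = ∑ j ∈ Finset.range (s + 1),
      Polynomial.C (trigEval (d j) (2 * t)) * Polynomial.X ^ j) {k : ℕ}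
    (hk : ∀ j ∈ Finset.range (s + 1), ∀ n ∈ (d j).support, n.natAbs ≤ k * (s - j)) :
    D.IsRescaled a k (MixedPoly.rescaledPoly s d k) := by
  intro u v hv
  have hr' : ((‖v‖ : ℝ) : ℂ) ≠ 0 := by exact_mod_cast norm_ne_zero_iff.2 hv
  have h := MixedPoly.toFun_rescaledPoly hk (u / (‖v‖ : ℂ) ^ (2 * k)) ‖v‖ v.arg
  rw [mul_div_cancel₀ _ (pow_ne_zero _ hr'), Complex.norm_mul_exp_arg_mul_I] at h
  rw [h, Complex.mul_conj', ← D.rootPoly_eval, hR, ← pow_mul, ← pow_mul]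
  simp only [Polynomial.eval_finsetSum, Polynomial.eval_mul, Polynomial.eval_C,
    Polynomial.eval_pow, Polynomial.eval_X]
  ring

theorem mainTheorem1 (s : ℕ) (hs : 0 < s) (B : BraidGroup s) (hB : IsSquare B)
    (D : FourierParam s) (hD : D.Parametrizes B) (hsq : D.IsDoubled)
    (a : ℝ) (ha : 0 < a) (hψ : ∀ t : ℝ, D.psi a t ≠ 0) :
    ∃ n' : ℕ, 0 < n' ∧ ∀ N : ℕ, n' ≤ N → ∃ k₀ : ℕ, 0 < k₀ ∧ ∀ k : ℕ, k₀ ≤ k →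
      ∃ p : MixedPoly 2, D.IsRescaled a k p ∧
        ∀ (m : ℕ) (hm : 0 < m) (θ : Fin m → Polynomial ℂ),
          (θ ⟨0, hm⟩).trailingDegree = (N : ℕ∞) →
          (MixedPoly.monicInU m θ).NonDegenerate →
          (p * MixedPoly.monicInU m θ).StronglyNonDegenerate ∧
            (p * MixedPoly.monicInU m θ).Convenient := by
  obtain ⟨d, hds, hR⟩ := D.exists_rootPoly_eq_sum hsq a
  obtain ⟨n', hn', hbound⟩ := D.exists_norm_deriv_lt hs ha hψ
    (b := fun j t => trigEval (d j) (2 * t))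
    (fun j => (contDiff_trigEval (d j)).comp (contDiff_const.mul contDiff_id)) hR
  refine ⟨n', hn', fun N hN => ?_⟩
  -- `k₁` bounds the frequencies of all the coefficients
  let k₁ : ℕ := (Finset.range (s + 1)).sup fun j => (d j).support.sup Int.natAbs
  refine ⟨N + 1 + k₁, by omega, fun k hk => ?_⟩
  have hfreq : ∀ j ∈ Finset.range (s + 1), ∀ n ∈ (d j).support, n.natAbs ≤ k * (s - j) := by
    intro j hj n hn
    rcases (Nat.lt_succ_iff.1 (Finset.mem_range.1 hj)).eq_or_lt with rfl | hjs
    · rw [hds] at hn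
      simp [Finset.mem_singleton.1 (Finsupp.support_single_subset hn)]
    · have h1 : n.natAbs ≤ k₁ := (Finset.le_sup (f := Int.natAbs) hn).trans
        (Finset.le_sup (f := fun j => (d j).support.sup Int.natAbs) hj)
      exact (h1.trans (by omega)).trans (Nat.le_mul_of_pos_right k (by omega))
  refine ⟨MixedPoly.rescaledPoly s d k, D.isRescaled_rescaledPoly hR hfreq,
    fun m hm θ hθ hq => ⟨?_, ?_⟩⟩
  · refine MixedPoly.stronglyNonDegenerate_rescaledPoly_mul_monicInU hs hds hR (by omega) hfreq
      (fun t ht w hw => ?_) hm hθ hq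
    obtain ⟨h1, h2⟩ := hbound t ht w hw
    exact ⟨h1, h2.trans_le (mul_le_mul_of_nonneg_right (by exact_mod_cast hN) (norm_nonneg _))⟩
  · refine MixedPoly.convenient_rescaledPoly_mul_monicInU (by omega) hds hfreq ?_ hm ?_
    · have h0 := D.rootPoly_eval_zero a 0
      rw [hR, Polynomial.eval_finsetSum, Finset.sum_eq_single_of_mem 0
        (Finset.mem_range.2 (by omega)) (fun j _ hj => by simp [hj])] at h0
      intro h
      simp only [mul_zero, h, map_zero, zero_mul, Polynomial.eval_zero] at h0
      exact mul_ne_zero (pow_ne_zero _ (by norm_num)) (hψ 0) h0.symm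
    · intro h
      rw [h, Polynomial.trailingDegree_zero] at hθ
      exact absurd hθ (by simp)
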